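/- All graphs are undirected, connected, locally finite, without loops or multiple edges. The space $\mathcal G_\bullet$ of isomorphism classes of rooted graphs $(G,\rho)$, the space $\mathcal G_\bullet^*$ of isomorphism classes of rooted conformal graphs $(G,\omega,\rho)$ with $\omega:V(G)\to[0,\infty)$, and their doubly-rooted versions carry the Borel $\sigma$-algebras of the local topology (two networks are close if, for some large $r$, their balls of radius $r$ around the root are isomorphic by an isomorphism that preserves the roots and changes $\omega$ by at most $1/r$). A random rooted graph (or rooted conformal graph) with law $\mu$ is unimodular if for every Borel function $F\ge 0$ on doubly-rooted (conformal) graphs $$\int \sum_{x\in V(G)} F(G,\rho,x)\,d\mu=\int\sum_{x\in V(G)}F(G,x,\rho)\,d\mu$$ (with $\omega$ as a further argument of $F$ in the conformal case). Let $(G,\rho)$ be a unimodular random graph. A normalized conformal metric on $(G,\rho)$ is a unimodular random conformal graph $(G',\omega,\rho')$ such that $(G',\rho')$ has the same law as $(G,\rho)$ and $\mathbb E[\omega(\rho')^2]=1$. Let $\mathrm{dist}_\omega(u,v)$ be the infimum, over all paths from $u$ to $v$, of the sum of the edge lengths $\frac12(\omega(a)+\omega(b))$ over the edges $\{a,b\}$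 of the path, and let $B_\omega(x,R)=\{y:\mathrm{dist}_\omega(x,y)\le R\}$. For $C>0$ and $R\ge1$, say that $(G,\rho)$ is $(C,R)$-quadratic if $$\inf_\omega \big\|\#B_\omega(\rho',R)\big\|_{L^\infty}\le C R^2,$$ where the infimum is over all normalized conformal metrics $(G',\omega,\rho')$ on $(G,\rho)$ and $\|\cdot\|_{L^\infty}$ is the essential supremum. Say that $(G,\rho)$ has asymptotic gauged quadratic conformal growth if there are a constant $C>0$ and a sequence of radii $R_n\ge 1$ with $R_n\to\infty$ such that $(G,\rho)$ is $(C,R_n)$-quadratic for all $n$. **Theorem.** If a unimodular random graph $(G,\rho)$ has asymptotic gauged quadratic conformal growth and $\|\deg_G(\rho)\|_{L^\infty}<\infty$, then $G$ is almost surely recurrent, i.e. almost surely the simple random walk on $G$ started at any vertex returns to that vertex with probability one. (On the graph with a single vertex the walk stays put.) -/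

import Mathlib

open MeasureTheory ProbabilityTheory Filter Topology
open scoped NNReal ENNReal

noncomputable section

/-! ## Rooted and doubly-rooted marked graphs -/

/-- A connected, locally finite graph without loops or multiple edges, with a mark in `M` at every
vertex and a root.  Such a graph is countable, so vertex sets in `Type` represent all of them.
The networks themselves are used, not their isomorphism classes; the topology below does not
separate isomorphic networks (see `RootedNetwork.mem_iff_of_iso`), so a Borel measure on this type
is the same thing as a Borel measure on the space of isomorphism classes. -/
structure RootedNetwork (M : Type) : Type 1 where
  V : Type
  graph : SimpleGraph V
  connected : graph.Connected
  locallyFinite : ∀ v : V, (graph.neighborSet v).Finite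
  mark : V → M
  root : V

/-- A marked graph with an ordered pair of roots `(root, root₂)`. -/
structure BirootedNetwork (M : Type) : Type 1 extends RootedNetwork M where
  root₂ : V

/-- Rooted graphs without marks. -/
abbrev RootedGraph : Type 1 := RootedNetwork Unit

/-- Rooted conformal graphs `(G, ω, ρ)`, with `ω : V(G) → [0, ∞)`. -/
abbrev RootedConformalGraph : Type 1 := RootedNetwork ℝ≥0

namespace RootedNetwork

variable {M : Type}

/-- The closed ball `B_G(ρ, r)` in the graph distance. -/
def ball (X : RootedNetwork M) (r : ℝ≥0) : Set X.V :=
  {v | (X.graph.dist X.root v : ℝ≥0) ≤ r}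

/-- The subgraph induced on `B_G(ρ, r)`. -/
abbrev ballGraph (X : RootedNetwork M) (r : ℝ≥0) : SimpleGraph (X.ball r) :=
  X.graph.induce (X.ball r)

/-- The `r`-balls at the roots are isomorphic by a root-preserving isomorphism that changes marks by
at most `1 / r`. -/
def Agree [PseudoMetricSpace M] (r : ℝ≥0) (X Y : RootedNetwork M) : Prop :=
  ∃ ψ : X.ballGraph r ≃g Y.ballGraph r,
    (∀ v : X.ball r, (ψ v : Y.V) = Y.root ↔ (v : X.V) = X.root) ∧
    ∀ v : X.ball r, dist (X.mark v) (Y.mark (ψ v)) ≤ 1 / (r : ℝ)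

/-- The local distance `1 / (1 + α)`, where `α` is the supremum of the radii `r > 0` at which the
two networks agree. -/
def locDist [PseudoMetricSpace M] (X Y : RootedNetwork M) : ℝ≥0∞ :=
  (1 + ⨆ (r : ℝ≥0) (_ : 0 < r ∧ Agree r X Y), (r : ℝ≥0∞))⁻¹

/-- The topology of the local distance. -/
instance [PseudoMetricSpace M] : TopologicalSpace (RootedNetwork M) where
  IsOpen U := ∀ X ∈ U, ∃ ε > 0, ∀ Y, locDist X Y < ε → Y ∈ U
  isOpen_univ := fun _ _ => ⟨1, one_pos, fun _ _ => trivial⟩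
  isOpen_inter := by
    rintro s t hs ht X ⟨h1, h2⟩
    obtain ⟨e1, he1, H1⟩ := hs X h1
    obtain ⟨e2, he2, H2⟩ := ht X h2
    exact ⟨min e1 e2, lt_min he1 he2, fun Y hY =>
      ⟨H1 Y (hY.trans_le (min_le_left _ _)), H2 Y (hY.trans_le (min_le_right _ _))⟩⟩
  isOpen_sUnion := by
    rintro S hS X ⟨t, htS, hX⟩
    obtain ⟨e, he, H⟩ := hS t htS X hX
    exact ⟨e, he, fun Y hY => ⟨t, htS, H Y hY⟩⟩

instance [PseudoMetricSpace M] : MeasurableSpace (RootedNetwork M) := borel _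

instance [PseudoMetricSpace M] : BorelSpace (RootedNetwork M) := ⟨rfl⟩

/-- Forget the marks. -/
def forget (X : RootedNetwork M) : RootedGraph where
  V := X.V
  graph := X.graph
  connected := X.connected
  locallyFinite := X.locallyFinite
  mark := fun _ => ()
  root := X.root

/-- The network `X` with the root replaced by the ordered pair of roots `(x, y)`. -/
def withRoots (X : RootedNetwork M) (x y : X.V) : BirootedNetwork M where
  V := X.V
  graph := X.graph
  connected := X.connected
  locallyFinite := X.locallyFinite
  mark := X.mark
  root := x
  root₂ := y

/-- The degree of the root. -/
def rootDegree (X : RootedNetwork M) : ℝ≥0∞ :=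
  ((X.graph.neighborSet X.root).encard : ℝ≥0∞)

/-- Isomorphism of rooted marked graphs. -/
def Iso (X Y : RootedNetwork M) : Prop :=
  ∃ φ : X.graph ≃g Y.graph, φ X.root = Y.root ∧ ∀ v, Y.mark (φ v) = X.mark v

end RootedNetwork

namespace BirootedNetwork

variable {M : Type}

/-- As for rooted networks, where the isomorphism of the `r`-balls around the first root now has to
preserve the second root as well (which may lie outside of both balls). -/
def Agree [PseudoMetricSpace M] (r : ℝ≥0) (X Y : BirootedNetwork M) : Prop :=
  ∃ ψ : X.ballGraph r ≃g Y.ballGraph r,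
    (∀ v : X.ball r, (ψ v : Y.V) = Y.root ↔ (v : X.V) = X.root) ∧
    (∀ v : X.ball r, (ψ v : Y.V) = Y.root₂ ↔ (v : X.V) = X.root₂) ∧
    ∀ v : X.ball r, dist (X.mark v) (Y.mark (ψ v)) ≤ 1 / (r : ℝ)

/-- The local distance on doubly-rooted networks. -/
def locDist [PseudoMetricSpace M] (X Y : BirootedNetwork M) : ℝ≥0∞ :=
  (1 + ⨆ (r : ℝ≥0) (_ : 0 < r ∧ Agree r X Y), (r : ℝ≥0∞))⁻¹

/-- The topology of the local distance. -/
instance [PseudoMetricSpace M] : TopologicalSpace (BirootedNetwork M) where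
  IsOpen U := ∀ X ∈ U, ∃ ε > 0, ∀ Y, locDist X Y < ε → Y ∈ U
  isOpen_univ := fun _ _ => ⟨1, one_pos, fun _ _ => trivial⟩
  isOpen_inter := by
    rintro s t hs ht X ⟨h1, h2⟩
    obtain ⟨e1, he1, H1⟩ := hs X h1
    obtain ⟨e2, he2, H2⟩ := ht X h2
    exact ⟨min e1 e2, lt_min he1 he2, fun Y hY =>
      ⟨H1 Y (hY.trans_le (min_le_left _ _)), H2 Y (hY.trans_le (min_le_right _ _))⟩⟩
  isOpen_sUnion := by
    rintro S hS X ⟨t, htS, hX⟩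
    obtain ⟨e, he, H⟩ := hS t htS X hX
    exact ⟨e, he, fun Y hY => ⟨t, htS, H Y hY⟩⟩

instance [PseudoMetricSpace M] : MeasurableSpace (BirootedNetwork M) := borel _

instance [PseudoMetricSpace M] : BorelSpace (BirootedNetwork M) := ⟨rfl⟩

end BirootedNetwork

/-! ## Isomorphic networks are not separated by Borel sets -/

theorem SimpleGraph.Iso.dist_apply_le {V W : Type} {G : SimpleGraph V} {H : SimpleGraph W}
    (hG : G.Connected) (φ : G ≃g H) (u v : V) : H.dist (φ u) (φ v) ≤ G.dist u v := by
  obtain ⟨p, hp⟩ := hG.exists_walk_length_eq_dist u v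
  have h := SimpleGraph.dist_le (p.map φ.toHom)
  rw [SimpleGraph.Walk.length_map, hp] at h
  exact h

theorem SimpleGraph.Iso.dist_apply {V W : Type} {G : SimpleGraph V} {H : SimpleGraph W}
    (hG : G.Connected) (hH : H.Connected) (φ : G ≃g H) (u v : V) :
    H.dist (φ u) (φ v) = G.dist u v := by
  refine le_antisymm (φ.dist_apply_le hG u v) ?_
  have h := φ.symm.dist_apply_le hH (φ u) (φ v)
  simpa using h

theorem RootedNetwork.Iso.symm {M : Type} {X Y : RootedNetwork M} (h : X.Iso Y) : Y.Iso X := by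
  obtain ⟨φ, hroot, hmark⟩ := h
  refine ⟨φ.symm, by rw [← hroot]; simp, fun v => ?_⟩
  rw [← hmark]; simp

theorem RootedNetwork.Iso.agree {M : Type} [PseudoMetricSpace M] {X Y : RootedNetwork M}
    (h : X.Iso Y) (r : ℝ≥0) : RootedNetwork.Agree r X Y := by
  obtain ⟨φ, hroot, hmark⟩ := h
  have hball : ∀ v, v ∈ X.ball r ↔ φ v ∈ Y.ball r := fun v => by
    simp only [RootedNetwork.ball, Set.mem_ofPred_eq]
    rw [← hroot, φ.dist_apply X.connected Y.connected]
  refine ⟨⟨φ.toEquiv.subtypeEquiv hball, ?_⟩, fun v => ?_, fun v => ?_⟩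
  · intro a b
    exact φ.map_rel_iff
  · change φ v = Y.root ↔ _
    rw [← hroot, φ.injective.eq_iff]
  · change dist _ (Y.mark (φ v)) ≤ _
    rw [hmark, dist_self]
    positivity

theorem RootedNetwork.Iso.locDist_eq_zero {M : Type} [PseudoMetricSpace M] {X Y : RootedNetwork M}
    (h : X.Iso Y) : RootedNetwork.locDist X Y = 0 := by
  rw [RootedNetwork.locDist, ENNReal.inv_eq_zero, ENNReal.add_eq_top]
  right
  rw [iSup_eq_top]
  intro b hb
  obtain ⟨r, hr⟩ := ENNReal.lt_iff_exists_nnreal_btwn.1 hb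
  refine ⟨r, ?_⟩
  have hr0 : 0 < r := by
    have := (zero_le (a := b)).trans_lt hr.1
    exact_mod_cast this
  rw [iSup_pos ⟨hr0, h.agree r⟩]
  exact hr.1

/-- Measurable sets of rooted networks are invariant under isomorphism. -/
theorem RootedNetwork.mem_iff_of_iso {M : Type} [PseudoMetricSpace M] {X Y : RootedNetwork M}
    (h : X.Iso Y) {A : Set (RootedNetwork M)} (hA : MeasurableSet A) : X ∈ A ↔ Y ∈ A := by
  induction A, hA using MeasurableSpace.generateFrom_induction with
  | hC U hU _ =>
    constructor
    · intro hX
      obtain ⟨e, he, H⟩ := hU X hX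
      exact H Y (by rw [h.locDist_eq_zero]; exact he)
    · intro hY
      obtain ⟨e, he, H⟩ := hU Y hY
      exact H X (by rw [h.symm.locDist_eq_zero]; exact he)
  | empty => exact Iff.rfl
  | compl t _ ih => exact not_congr ih
  | iUnion s _ ih =>
    simp only [Set.mem_iUnion]
    exact exists_congr ih

/-! ## Unimodularity -/

/-- A probability measure on rooted networks is unimodular if it satisfies the mass-transport
principle. -/
structure IsUnimodular {M : Type} [PseudoMetricSpace M] (μ : Measure (RootedNetwork M)) : Prop where
  isProbabilityMeasure : IsProbabilityMeasure μ
  mass_transport : ∀ F : BirootedNetwork M → ℝ≥0∞, Measurable F →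
    ∫⁻ X, ∑' x : X.V, F (X.withRoots X.root x) ∂μ = ∫⁻ X, ∑' x : X.V, F (X.withRoots x X.root) ∂μ

/-! ## Conformal metrics and their growth -/

/-- The length of a walk, where the edge `{u, v}` has length `(ω u + ω v) / 2`. -/
def confLength {V : Type} {G : SimpleGraph V} (ω : V → ℝ≥0) {u v : V} (p : G.Walk u v) : ℝ≥0 :=
  (p.darts.map fun d => (ω d.fst + ω d.snd) / 2).sum

/-- The conformal distance: the infimum of the lengths of all walks from `u` to `v`. -/
def confDist {V : Type} (G : SimpleGraph V) (ω : V → ℝ≥0) (u v : V) : ℝ≥0∞ :=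
  ⨅ p : G.Walk u v, (confLength ω p : ℝ≥0∞)

/-- The closed ball `B_ω(x, R)` of the conformal distance. -/
def confBall {V : Type} (G : SimpleGraph V) (ω : V → ℝ≥0) (x : V) (R : ℝ) : Set V :=
  {y | confDist G ω x y ≤ ENNReal.ofReal R}

/-- `ν` is the law of a normalized conformal metric on the random rooted graph with law `μ`: it is a
unimodular random conformal graph `(G', ω, ρ')` such that `(G', ρ')` has law `μ`, and
`E[ω(ρ')²] = 1`. -/
structure IsNormalizedConformalMetric (μ : Measure RootedGraph)
    (ν : Measure RootedConformalGraph) : Prop where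
  isUnimodular : IsUnimodular ν
  map_forget : ν.map RootedNetwork.forget = μ
  normalized : ∫⁻ X, (X.mark X.root : ℝ≥0∞) ^ 2 ∂ν = 1

/-- `‖#B_ω(ρ, R)‖_{L^∞}` for a random conformal graph with law `ν`. -/
def ballGrowth (ν : Measure RootedConformalGraph) (R : ℝ) : ℝ≥0∞ :=
  essSup (fun X => ((confBall X.graph X.mark X.root R).encard : ℝ≥0∞)) ν

/-- `(C, R)`-quadratic random rooted graphs. -/
def IsQuadratic (μ : Measure RootedGraph) (C R : ℝ) : Prop :=
  ⨅ (ν : Measure RootedConformalGraph) (_ : IsNormalizedConformalMetric μ ν), ballGrowth ν R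
    ≤ ENNReal.ofReal (C * R ^ 2)

/-- Asymptotic gauged quadratic conformal growth. -/
def HasAsymptoticGQCG (μ : Measure RootedGraph) : Prop :=
  ∃ C : ℝ, 0 < C ∧ ∃ R : ℕ → ℝ, (∀ n, 1 ≤ R n) ∧ Tendsto R atTop atTop ∧ ∀ n, IsQuadratic μ C (R n)

/-! ## Simple random walk and recurrence -/

/-- One step of the simple random walk: a uniformly random neighbor of `x`.  At an isolated vertex
(which, in a connected graph, is the only vertex) the walk stays put. -/
def walkStep {V : Type} (G : SimpleGraph V) (hG : ∀ v, (G.neighborSet v).Finite) (x : V) : PMF V :=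
  open Classical in
  if h : (hG x).toFinset.Nonempty then PMF.uniformOfFinset (hG x).toFinset h else PMF.pure x

/-- The transition kernel of the simple random walk. -/
def walkKernel {V : Type} [MeasurableSpace V] [DiscreteMeasurableSpace V] (G : SimpleGraph V)
    (hG : ∀ v, (G.neighborSet v).Finite) : Kernel V V where
  toFun x := (walkStep G hG x).toMeasure
  measurable' := Measurable.of_discrete

instance {V : Type} [MeasurableSpace V] [DiscreteMeasurableSpace V] (G : SimpleGraph V)
    (hG : ∀ v, (G.neighborSet v).Finite) : IsMarkovKernel (walkKernel G hG) :=
  ⟨fun x => PMF.toMeasure.isProbabilityMeasure (walkStep G hG x)⟩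

/-- The law of the trajectory `(X₀, X₁, X₂, …)` of the simple random walk with `X₀ = x`. -/
def walkLaw {V : Type} [MeasurableSpace V] [DiscreteMeasurableSpace V] (G : SimpleGraph V)
    (hG : ∀ v, (G.neighborSet v).Finite) (x : V) : Measure (ℕ → V) :=
  Kernel.trajMeasure (X := fun _ => V) (Measure.dirac x) fun n =>
    (walkKernel G hG).comap (fun h : (i : Finset.Iic n) → V => h ⟨n, Finset.mem_Iic.2 le_rfl⟩)
      (measurable_pi_apply _)

/-- A graph is recurrent if, from every vertex, the simple random walk almost surely returns to its
starting point. -/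
def IsRecurrent {V : Type} (G : SimpleGraph V) (hG : ∀ v, (G.neighborSet v).Finite) : Prop :=
  letI : MeasurableSpace V := ⊤
  haveI : DiscreteMeasurableSpace V := ⟨fun _ => trivial⟩
  ∀ x : V, ∀ᵐ ξ ∂(walkLaw G hG x), ∃ n ≥ 1, ξ n = x

end

/-! The argument builds cutoff functions of bounded energy out of conformal metrics and shows that
such cutoffs force recurrence.

Let `D` bound the degree. Take a normalized conformal metric ω whose `R`-balls have at most `(C + 1)
* R ^ 2` points, and put `f = max 0 (1 - dist_ω(ρ, ·) / R)`. On an edge `f` changes by at most the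
edge length over `R`, so its energy is at most `(D + 1) / R ^ 2` times the sum of ω² over closed
neighborhoods of the points with `dist_ω < R` (`hasCutoff_of_confSquare_le`). Mass transport turns
the expectation of that sum into one at the root, bounded by the ball growth times `D + 1`
(`lintegral_confSquare_le`). The powers of `R` cancel, so by Markov the energy is at most `(D + 1) *
t` up to probability `(C + 1) * (D + 1) / t`. Mass transport also bounds the expected sum of ω² over
the graph ball of radius `k` by `(D + 1) ^ k` (`lintegral_nearSquare_le`). With high probability for
large `R`, ω is therefore small compared with `R` on that ball, and `f` is close to `1` there.

Whether a cutoff at level `k` exists depends on the graph alone, so letting `R` tend to infinity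
along the given radii removes the second error. Failure at level `k` increases with `k`, so failure
at some level still has probability at most `(C + 1) * (D + 1) / t`; finally `t` tends to infinity.

The energies are only bounded and need not tend to zero. That suffices (`isRecurrent_of_cutoff`):
let `u` be the probability of never hitting `x`, set to `0` at `x`. Testing harmonicity against `f ^
2 * u` shows that `u` has finite energy (`energy_le_of_cutoff`). Testing against `f` then shows that
the flux of `u` at `x` vanishes (`sum_neighbors_eq_zero_of_cutoff`), and this flux is the escape
probability up to the degree.

Measurability comes from semicontinuity in the local topology: the cutoff event is open, and the
functionals used in mass transport are lower semicontinuous. -/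

noncomputable section

/-! ## Escape probabilities of the simple random walk -/

/-- The expectation of `h` after one step of the simple random walk from `y`. -/
def walkAvg {V : Type} {G : SimpleGraph V} (hG : ∀ v, (G.neighborSet v).Finite) (h : V → ℝ)
    (y : V) : ℝ :=
  open Classical in
  if (hG y).toFinset.Nonempty then (∑ z ∈ (hG y).toFinset, h z) / (hG y).toFinset.card else h y

/-- The probability that the simple random walk from `y` avoids `x` at the times `1, …, n`. -/
def avoidProb {V : Type} {G : SimpleGraph V} (hG : ∀ v, (G.neighborSet v).Finite) (x : V) :
    ℕ → V → ℝ
  | 0 => fun _ => 1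
  | n + 1 => walkAvg hG (Set.indicator {x}ᶜ (avoidProb hG x n))

section Walk

variable {V : Type} {G : SimpleGraph V} (hG : ∀ v, (G.neighborSet v).Finite)

theorem walkAvg_mono {h k : V → ℝ} (hk : h ≤ k) : walkAvg hG h ≤ walkAvg hG k := by
  intro y
  unfold walkAvg
  split_ifs
  · gcongr
    exact hk _
  · exact hk y

theorem walkAvg_const (c : ℝ) : walkAvg hG (fun _ => c) = fun _ => c := by
  ext y
  unfold walkAvg
  split_ifs with h
  · have : ((hG y).toFinset.card : ℝ) ≠ 0 := by simpa using h.card_pos.ne'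
    simp only [Finset.sum_const, nsmul_eq_mul]
    field_simp
  · rfl

theorem walkAvg_tendsto {h : ℕ → V → ℝ} {k : V → ℝ}
    (hk : ∀ y, Tendsto (fun n => h n y) atTop (𝓝 (k y))) (y : V) :
    Tendsto (fun n => walkAvg hG (h n) y) atTop (𝓝 (walkAvg hG k y)) := by
  unfold walkAvg
  split_ifs with h
  · exact (tendsto_finsetSum _ fun z _ => hk z).div_const _
  · exact hk y

theorem avoidProb_nonneg (x : V) (n : ℕ) : 0 ≤ avoidProb hG x n := by
  induction n with
  | zero => exact fun _ => zero_le_one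
  | succ n ih =>
    have h := walkAvg_mono hG (h := fun _ => 0) (Set.indicator_nonneg (s := {x}ᶜ) fun y _ => ih y)
    rwa [walkAvg_const] at h

theorem avoidProb_antitone (x : V) : Antitone (avoidProb hG x) := by
  refine antitone_nat_of_succ_le fun n => ?_
  induction n with
  | zero =>
    have h := walkAvg_mono hG (k := fun _ => 1) (h := Set.indicator {x}ᶜ (fun _ => 1))
      (Set.indicator_le_self' fun _ _ => zero_le_one)
    rwa [walkAvg_const] at h
  | succ n ih =>
    refine walkAvg_mono hG fun y => ?_
    exact Set.indicator_le_indicator (ih y)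

/-- The probability that the simple random walk from `y` avoids `x` at all positive times. -/
def avoidLim (x y : V) : ℝ := ⨅ n, avoidProb hG x n y

theorem tendsto_avoidProb (x y : V) :
    Tendsto (fun n => avoidProb hG x n y) atTop (𝓝 (avoidLim hG x y)) :=
  tendsto_atTop_ciInf (fun _ _ h => avoidProb_antitone hG x h y)
    ⟨0, by rintro _ ⟨n, rfl⟩; exact avoidProb_nonneg hG x n y⟩

theorem avoidLim_nonneg (x y : V) : 0 ≤ avoidLim hG x y :=
  ge_of_tendsto' (tendsto_avoidProb hG x y) fun n => avoidProb_nonneg hG x n y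

theorem avoidLim_le_one (x y : V) : avoidLim hG x y ≤ 1 :=
  le_of_tendsto' (tendsto_avoidProb hG x y) fun n => avoidProb_antitone hG x (Nat.zero_le n) y

/-- One step averages over finitely many neighbors, so the recursion for `avoidProb` passes to the
pointwise limit. -/
theorem avoidLim_eq (x y : V) :
    avoidLim hG x y = walkAvg hG (Set.indicator {x}ᶜ (avoidLim hG x)) y := by
  refine tendsto_nhds_unique ((tendsto_avoidProb hG x y).comp (tendsto_add_atTop_nat 1)) ?_
  refine walkAvg_tendsto hG (h := fun n => Set.indicator {x}ᶜ (avoidProb hG x n))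
    (k := Set.indicator {x}ᶜ (avoidLim hG x)) (fun z => ?_) y
  by_cases hz : z = x
  · simp [hz]
  · simpa [hz] using tendsto_avoidProb hG x z

/-! ### Avoidance probabilities as probabilities of path events. -/

variable [MeasurableSpace V] [DiscreteMeasurableSpace V]

theorem lintegral_walkStep {h : V → ℝ} (h0 : 0 ≤ h) (y : V) :
    ∫⁻ z, ENNReal.ofReal (h z) ∂(walkStep G hG y).toMeasure = ENNReal.ofReal (walkAvg hG h y) := by
  classical
  unfold walkStep walkAvg
  split_ifs with hne
  · have key : (PMF.uniformOfFinset (hG y).toFinset hne).toMeasure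
        = ∑ z ∈ (hG y).toFinset, ((hG y).toFinset.card : ℝ≥0∞)⁻¹ • Measure.dirac z := by
      ext s hs
      rw [PMF.toMeasure_uniformOfFinset_apply _ _ hs]
      simp only [Measure.coe_finsetSum, Finset.sum_apply, Measure.smul_apply,
        Measure.dirac_apply' _ hs, smul_eq_mul, ← Finset.mul_sum]
      rw [div_eq_mul_inv, mul_comm, Finset.card_filter]
      congr 1
      simp [Set.indicator_apply]
    rw [key, lintegral_finsetSum_measure]
    have hpos : (0 : ℝ) < (hG y).toFinset.card := by exact_mod_cast hne.card_pos
    rw [ENNReal.ofReal_div_of_pos hpos, ENNReal.ofReal_sum_of_nonneg fun z _ => h0 z,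
      ENNReal.ofReal_natCast, div_eq_mul_inv, mul_comm, Finset.mul_sum]
    simp [lintegral_smul_measure]
  · rw [PMF.toMeasure_pure, lintegral_dirac]

theorem map_walkLaw_zero (x : V) :
    (walkLaw G hG x).map (fun ξ => ξ 0) = Measure.dirac x := by
  have h : (fun ξ : ℕ → V => ξ 0)
      = (fun g : (i : Finset.Iic 0) → V => g ⟨0, Finset.mem_Iic.2 le_rfl⟩) ∘
        Preorder.frestrictLe 0 := rfl
  rw [h, ← Measure.map_map (by fun_prop) (by fun_prop), walkLaw, Kernel.trajMeasure,
    Measure.map_comp _ _ (by fun_prop), Kernel.traj_map_frestrictLe, Kernel.partialTraj_self,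
    Measure.id_comp, Measure.map_map (by fun_prop) (by fun_prop), Measure.map_dirac' (by fun_prop)]
  rfl

/-- The Markov property at time `n`: the domain of integration is determined by the path up to time
`n`, and the next position is drawn from `walkStep`. -/
theorem setLIntegral_walkLaw_succ (x : V) (n : ℕ) {s : Set ((i : Finset.Iic n) → V)}
    (hs : MeasurableSet s) {h : V → ℝ} (h0 : 0 ≤ h) :
    ∫⁻ ξ in Preorder.frestrictLe n ⁻¹' s, ENNReal.ofReal (h (ξ (n + 1))) ∂(walkLaw G hG x) =
      ∫⁻ ξ in Preorder.frestrictLe n ⁻¹' s, ENNReal.ofReal (walkAvg hG h (ξ n))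
        ∂(walkLaw G hG x) := by
  have hmeas : Measurable fun p : ((i : Finset.Iic n) → V) × V =>
      s.indicator (1 : ((i : Finset.Iic n) → V) → ℝ≥0∞) p.1 * ENNReal.ofReal (h p.2) :=
    ((measurable_one.indicator hs).comp measurable_fst).mul
      ((Measurable.of_discrete (f := fun z => ENNReal.ofReal (h z))).comp measurable_snd)
  have hpre : MeasurableSet (Preorder.frestrictLe (π := fun _ => V) n ⁻¹' s) :=
    hs.preimage (by fun_prop)
  have key := congrArg (fun m => ∫⁻ p, s.indicator (1 : ((i : Finset.Iic n) → V) → ℝ≥0∞) p.1 * ENNReal.ofReal (h p.2) ∂m)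
    (Kernel.map_frestrictLe_trajMeasure_compProd_eq_map_trajMeasure (X := fun _ => V)
      (μ₀ := Measure.dirac x) (a := n) (κ := fun n =>
        (walkKernel G hG).comap (fun h : (i : Finset.Iic n) → V => h ⟨n, Finset.mem_Iic.2 le_rfl⟩)
          (measurable_pi_apply _)))
  rw [Measure.lintegral_compProd hmeas, lintegral_map hmeas (by fun_prop),
    lintegral_map (Measurable.lintegral_kernel_prod_right' hmeas) (by fun_prop)] at key
  rw [← lintegral_indicator hpre, ← lintegral_indicator hpre]
  refine Eq.trans ?_ (key.symm.trans ?_)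
  · refine lintegral_congr fun ξ => ?_
    by_cases hξ : Preorder.frestrictLe n ξ ∈ s
    · rw [Set.indicator_of_mem (by exact hξ), Set.indicator_of_mem hξ, Pi.one_apply, one_mul]
    · rw [Set.indicator_of_notMem (by exact hξ), Set.indicator_of_notMem hξ, zero_mul]
  · refine lintegral_congr fun ξ => ?_
    by_cases hξ : Preorder.frestrictLe n ξ ∈ s
    · simp only [Set.indicator_of_mem hξ, Pi.one_apply, one_mul]
      rw [Set.indicator_of_mem (by exact hξ)]
      exact lintegral_walkStep hG h0 (ξ n)
    · simp only [Set.indicator_of_notMem hξ, zero_mul, lintegral_zero]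
      rw [Set.indicator_of_notMem (by exact hξ)]

/-- The Markov property trades the last step of the path for one more step in `avoidProb`, hence the
induction with `m` free. The case `m = 0` gives the probability of avoiding `x` at times `1, …, n`.
-/
theorem setLIntegral_walkLaw_avoidProb (x : V) (n m : ℕ) :
    ∫⁻ ξ in {ξ : ℕ → V | ∀ i, 1 ≤ i → i ≤ n → ξ i ≠ x}, ENNReal.ofReal (avoidProb hG x m (ξ n))
      ∂(walkLaw G hG x) = ENNReal.ofReal (avoidProb hG x (m + n) x) := by
  induction n generalizing m with
  | zero =>
    have h : {ξ : ℕ → V | ∀ i, 1 ≤ i → i ≤ 0 → ξ i ≠ x} = Set.univ :=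
      Set.eq_univ_of_forall fun ξ i h1 h2 => by omega
    rw [h, Measure.restrict_univ, ← lintegral_map (μ := walkLaw G hG x)
      (f := fun z => ENNReal.ofReal (avoidProb hG x m z)) (g := fun ξ => ξ 0)
      Measurable.of_discrete (by fun_prop), map_walkLaw_zero, lintegral_dirac, add_zero]
  | succ n ih =>
    have hs : MeasurableSet {g : (i : Finset.Iic n) → V | ∀ i, 1 ≤ i.1 → g i ≠ x} := by
      have : {g : (i : Finset.Iic n) → V | ∀ i, 1 ≤ i.1 → g i ≠ x}
          = ⋂ i : Finset.Iic n, ⋂ (_ : 1 ≤ i.1), (fun g => g i) ⁻¹' {x}ᶜ := by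
        ext g; simp
      rw [this]
      exact MeasurableSet.iInter fun i => MeasurableSet.iInter fun _ =>
        (MeasurableSet.of_discrete (s := {x}ᶜ)).preimage (measurable_pi_apply i)
    have hpre : Preorder.frestrictLe (π := fun _ => V) n ⁻¹'
        {g : (i : Finset.Iic n) → V | ∀ i, 1 ≤ i.1 → g i ≠ x}
          = {ξ : ℕ → V | ∀ i, 1 ≤ i → i ≤ n → ξ i ≠ x} := by
      ext ξ
      simp only [Set.mem_preimage, Set.mem_ofPred_eq, Subtype.forall, Finset.mem_Iic]
      exact forall_congr' fun i => ⟨fun H h1 h2 => H h2 h1, fun H h1 h2 => H h2 h1⟩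
    have hne : MeasurableSet {ξ : ℕ → V | ξ (n + 1) ≠ x} :=
      (MeasurableSet.of_discrete (s := {x}ᶜ)).preimage (measurable_pi_apply (n + 1))
    have hset : {ξ : ℕ → V | ∀ i, 1 ≤ i → i ≤ n + 1 → ξ i ≠ x}
        = {ξ | ξ (n + 1) ≠ x} ∩ {ξ | ∀ i, 1 ≤ i → i ≤ n → ξ i ≠ x} := by
      ext ξ
      constructor
      · exact fun H => ⟨H (n + 1) (by omega) le_rfl, fun i h1 h2 => H i h1 (by omega)⟩
      · rintro ⟨H1, H2⟩ i h1 h2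
        rcases Nat.le_succ_iff.1 h2 with h | h
        · exact H2 i h1 h
        · exact h ▸ H1
    have step := setLIntegral_walkLaw_succ hG x n hs
      (h := Set.indicator {x}ᶜ (avoidProb hG x m))
      (Set.indicator_nonneg fun y _ => avoidProb_nonneg hG x m y)
    rw [hpre] at step
    rw [hset, ← Measure.restrict_restrict hne, ← lintegral_indicator hne,
      show m + (n + 1) = m + 1 + n by omega, ← ih (m + 1)]
    refine Eq.trans (lintegral_congr fun ξ => ?_) step
    by_cases hξ : ξ (n + 1) = x <;> simp [hξ]

end Walk

/-- If the avoidance probability at `x` vanishes, then the walk returns to `x`. -/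
theorem isRecurrent_of_avoidLim_eq_zero {V : Type} {G : SimpleGraph V}
    (hG : ∀ v, (G.neighborSet v).Finite) (h : ∀ x, avoidLim hG x x = 0) : IsRecurrent G hG := by
  let : MeasurableSpace V := ⊤
  have : DiscreteMeasurableSpace V := ⟨fun _ => trivial⟩
  intro x
  rw [ae_iff]
  have hn : ∀ n, walkLaw G hG x {ξ | ¬ ∃ n ≥ 1, ξ n = x} ≤ ENNReal.ofReal (avoidProb hG x n x) := by
    intro n
    have := setLIntegral_walkLaw_avoidProb hG x n 0
    simp only [avoidProb, ENNReal.ofReal_one, lintegral_one, Measure.restrict_apply_univ,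
      zero_add] at this
    rw [← this]
    refine measure_mono fun ξ hξ i h1 _ hi => hξ ⟨i, h1, hi⟩
  have hlim := (ENNReal.continuous_ofReal.tendsto _).comp (tendsto_avoidProb hG x x)
  rw [h x, ENNReal.ofReal_zero] at hlim
  exact le_antisymm (ge_of_tendsto' hlim hn) (zero_le)

/-! ## Recurrence from cutoff functions of bounded energy -/

/-- There is a finitely supported function of Dirichlet energy at most `2 * K` that is within
`1 / (k + 1)` of `1` on the ball of radius `k` around `ρ`. -/
def HasCutoff {V : Type} (G : SimpleGraph V) (hG : ∀ v, (G.neighborSet v).Finite) (ρ : V)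
    (K : ℝ) (k : ℕ) : Prop :=
  ∃ (S : Finset V) (f : V → ℝ), (∀ x ∉ S, f x = 0) ∧
    (∀ x, G.dist ρ x ≤ k → x ∈ S ∧ |1 - f x| ≤ 1 / ((k : ℝ) + 1)) ∧
    ∑ x ∈ S, ∑ y ∈ (hG x).toFinset, (f x - f y) ^ 2 ≤ K

theorem HasCutoff.mono {V : Type} {G : SimpleGraph V} {hG : ∀ v, (G.neighborSet v).Finite} {ρ : V}
    {K : ℝ} {j k : ℕ} (hjk : j ≤ k) (h : HasCutoff G hG ρ K k) : HasCutoff G hG ρ K j := by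
  obtain ⟨S, f, h1, h2, h3⟩ := h
  refine ⟨S, f, h1, fun x hx => ⟨(h2 x (hx.trans hjk)).1, (h2 x (hx.trans hjk)).2.trans ?_⟩, h3⟩
  gcongr

section Dirichlet

variable {V : Type} {G : SimpleGraph V} (hG : ∀ v, (G.neighborSet v).Finite)

open Classical in
/-- The indicator of adjacency. -/
def adjWeight (G : SimpleGraph V) (p : V × V) : ℝ := if G.Adj p.1 p.2 then 1 else 0

theorem adjWeight_nonneg (p : V × V) : 0 ≤ adjWeight G p := by
  unfold adjWeight; split_ifs <;> norm_num

theorem adjWeight_swap (p : V × V) : adjWeight G p.swap = adjWeight G p := by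
  classical exact if_congr (G.adj_comm p.2 p.1) rfl rfl

theorem sum_product_swap (T : Finset V) (g : V × V → ℝ) :
    ∑ p ∈ T ×ˢ T, g p.swap = ∑ p ∈ T ×ˢ T, g p := by
  rw [Finset.sum_product, Finset.sum_product_right]
  rfl

theorem sum_adjWeight_mul {T : Finset V} {x : V} (hT : (hG x).toFinset ⊆ T) (g : V → ℝ) :
    ∑ y ∈ T, adjWeight G (x, y) * g y = ∑ y ∈ (hG x).toFinset, g y := by
  classical
  rw [← Finset.sum_subset hT]
  · refine Finset.sum_congr rfl fun y hy => ?_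
    have : G.Adj x y := by simpa using hy
    simp [adjWeight, this]
  · intro y _ hy
    have : ¬ G.Adj x y := by simpa using hy
    simp [adjWeight, this]

theorem sum_adjWeight_mul_le (T : Finset V) (x : V) {g : V → ℝ} (h0 : 0 ≤ g) :
    ∑ y ∈ T, adjWeight G (x, y) * g y ≤ ∑ y ∈ (hG x).toFinset, g y := by
  classical
  rw [← sum_adjWeight_mul hG (T := T ∪ (hG x).toFinset) Finset.subset_union_right]
  exact Finset.sum_le_sum_of_subset_of_nonneg Finset.subset_union_left fun y _ _ =>
    mul_nonneg (adjWeight_nonneg _) (h0 y)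

/-- Discrete integration by parts. -/
theorem sum_gradient_mul {S T : Finset V} (hST : S ⊆ T)
    (hT : ∀ x ∈ S, (hG x).toFinset ⊆ T) {f : V → ℝ} (hf : ∀ x ∉ S, f x = 0) (u : V → ℝ) :
    ∑ p ∈ T ×ˢ T, adjWeight G p * ((u p.1 - u p.2) * (f p.1 - f p.2)) =
      2 * ∑ x ∈ S, f x * ∑ y ∈ (hG x).toFinset, (u x - u y) := by
  have h1 : ∑ p ∈ T ×ˢ T, adjWeight G p * ((u p.1 - u p.2) * f p.1)
      = ∑ x ∈ S, f x * ∑ y ∈ (hG x).toFinset, (u x - u y) := by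
    rw [Finset.sum_product, ← Finset.sum_subset hST]
    · refine Finset.sum_congr rfl fun x hx => ?_
      rw [← sum_adjWeight_mul hG (hT x hx), Finset.mul_sum]
      exact Finset.sum_congr rfl fun y _ => by ring
    · intro x _ hx
      simp [hf x hx]
  have h2 : ∑ p ∈ T ×ˢ T, adjWeight G p * ((u p.2 - u p.1) * f p.2)
      = ∑ p ∈ T ×ˢ T, adjWeight G p * ((u p.1 - u p.2) * f p.1) := by
    rw [← sum_product_swap T fun p => adjWeight G p * ((u p.1 - u p.2) * f p.1)]
    exact Finset.sum_congr rfl fun p _ => by rw [adjWeight_swap]; rfl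
  rw [two_mul, ← h1]
  nth_rewrite 2 [← h2]
  rw [← Finset.sum_add_distrib]
  exact Finset.sum_congr rfl fun p _ => by ring

/-- A nonzero difference needs an endpoint in `S`; the factor `2` accounts for it being the first or
the second one. -/
theorem sum_gradient_sq_le {S : Finset V} (T : Finset V) {f : V → ℝ} (hf : ∀ x ∉ S, f x = 0) :
    ∑ p ∈ T ×ˢ T, adjWeight G p * (f p.1 - f p.2) ^ 2 ≤
      2 * ∑ x ∈ S, ∑ y ∈ (hG x).toFinset, (f x - f y) ^ 2 := by
  classical
  have h1 : ∑ p ∈ T ×ˢ T, adjWeight G p * (f p.1 - f p.2) ^ 2 * (if p.1 ∈ S then 1 else 0)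
      ≤ ∑ x ∈ S, ∑ y ∈ (hG x).toFinset, (f x - f y) ^ 2 := by
    rw [Finset.sum_product]
    have : ∀ x ∈ T, ∑ y ∈ T, adjWeight G (x, y) * (f x - f y) ^ 2 * (if x ∈ S then 1 else 0)
        ≤ if x ∈ S then ∑ y ∈ (hG x).toFinset, (f x - f y) ^ 2 else 0 := by
      intro x _
      split_ifs
      · simpa using sum_adjWeight_mul_le hG T x (g := fun y => (f x - f y) ^ 2)
          fun y => sq_nonneg _
      · simp
    refine (Finset.sum_le_sum this).trans ?_
    rw [← Finset.sum_filter]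
    refine Finset.sum_le_sum_of_subset_of_nonneg (fun x hx => (Finset.mem_filter.1 hx).2)
      fun x _ _ => Finset.sum_nonneg fun y _ => sq_nonneg _
  have h2 : ∑ p ∈ T ×ˢ T, adjWeight G p * (f p.1 - f p.2) ^ 2 * (if p.2 ∈ S then 1 else 0)
      = ∑ p ∈ T ×ˢ T, adjWeight G p * (f p.1 - f p.2) ^ 2 * (if p.1 ∈ S then 1 else 0) := by
    rw [← sum_product_swap T fun p =>
      adjWeight G p * (f p.1 - f p.2) ^ 2 * (if p.1 ∈ S then 1 else 0)]
    refine Finset.sum_congr rfl fun p _ => ?_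
    rw [adjWeight_swap, Prod.fst_swap, Prod.snd_swap]
    ring
  rw [two_mul]
  refine le_trans ?_ (add_le_add h1 (h2.trans_le h1))
  rw [← Finset.sum_add_distrib]
  refine Finset.sum_le_sum fun p _ => ?_
  have h0 : 0 ≤ adjWeight G p * (f p.1 - f p.2) ^ 2 :=
    mul_nonneg (adjWeight_nonneg p) (sq_nonneg _)
  by_cases ha : p.1 ∈ S <;> by_cases hb : p.2 ∈ S <;> simp [ha, hb, hf]
  nlinarith

/-! ### Finite energy and vanishing flux of harmonic functions. -/

/-- The pointwise inequality behind the Caccioppoli estimate. -/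
theorem caccioppoli_pointwise {a b : ℝ} (ha : 0 ≤ a) (ha1 : a ≤ 1) (hb : 0 ≤ b) (hb1 : b ≤ 1)
    (p q : ℝ) :
    (a - b) ^ 2 * (p ^ 2 + q ^ 2) / 4 ≤
      (a - b) * (p ^ 2 * a - q ^ 2 * b) + 2 * (p - q) ^ 2 := by
  -- With `X = (a - b) * (p + q)` and `Y = (a + b) * (p - q)`, the cross term `X * Y / 2` is at
  -- least `-X ^ 2 / 8 - Y ^ 2 / 2`. The first loss costs half of the main term, the second at most
  -- `2 * (p - q) ^ 2`.
  have h1 : (a - b) * (p ^ 2 * a - q ^ 2 * b)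
      = (a - b) ^ 2 * (p ^ 2 + q ^ 2) / 2 + ((a - b) * (p + q)) * ((a + b) * (p - q)) / 2 := by ring
  have h2 : ((a + b) * (p - q)) ^ 2 ≤ 4 * (p - q) ^ 2 := by
    rw [mul_pow]
    have : (a + b) ^ 2 ≤ 4 := by nlinarith
    exact mul_le_mul_of_nonneg_right this (sq_nonneg _)
  have h3 : ((a - b) * (p + q)) ^ 2 ≤ (a - b) ^ 2 * (2 * (p ^ 2 + q ^ 2)) := by
    rw [mul_pow]
    exact mul_le_mul_of_nonneg_left (by nlinarith [sq_nonneg (p - q)]) (sq_nonneg _)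
  nlinarith [sq_nonneg ((a - b) * (p + q) / 2 + (a + b) * (p - q))]

theorem tendsto_cutoff {ρ : V} {S : ℕ → Finset V} {f : ℕ → V → ℝ}
    (hone : ∀ k : ℕ, ∀ x, G.dist ρ x ≤ k → x ∈ S k ∧ |1 - f k x| ≤ 1 / ((k : ℝ) + 1)) (x : V) :
    Tendsto (fun k => f k x) atTop (𝓝 1) := by
  rw [tendsto_iff_norm_sub_tendsto_zero]
  refine squeeze_zero' (Eventually.of_forall fun _ => norm_nonneg _) ?_
    tendsto_one_div_add_atTop_nhds_zero_nat
  filter_upwards [eventually_ge_atTop (G.dist ρ x)] with k hk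
  rw [Real.norm_eq_abs, abs_sub_comm]
  exact (hone k x hk).2

/-- A function with values in `[0, 1]` that is harmonic off its zero set has finite energy. -/
theorem energy_le_of_cutoff {ρ : V} {K : ℝ} (hcut : ∀ k, HasCutoff G hG ρ K k) {u : V → ℝ}
    (u0 : 0 ≤ u) (u1 : ∀ x, u x ≤ 1)
    (hu : ∀ x, u x ≠ 0 → ∑ y ∈ (hG x).toFinset, (u x - u y) = 0) (F : Finset V) :
    ∑ p ∈ F ×ˢ F, adjWeight G p * (u p.1 - u p.2) ^ 2 ≤ 8 * K := by
  classical
  choose S f hf hone hK using hcut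
  have hbound : ∀ k, ∑ p ∈ F ×ˢ F, adjWeight G p *
      ((u p.1 - u p.2) ^ 2 * (f k p.1 ^ 2 + f k p.2 ^ 2) / 4) ≤ 4 * K := by
    intro k
    set T := F ∪ (S k ∪ (S k).biUnion fun x => (hG x).toFinset)
    have hFT : F ⊆ T := Finset.subset_union_left
    have hST : S k ⊆ T := Finset.subset_union_left.trans Finset.subset_union_right
    have hNT : ∀ x ∈ S k, (hG x).toFinset ⊆ T := fun x hx =>
      (Finset.subset_biUnion_of_mem (fun x => (hG x).toFinset) hx).trans
        (Finset.subset_union_right.trans Finset.subset_union_right)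
    -- The test function `f ^ 2 * u` vanishes wherever `u` does, so the pairing with the Laplacian
    -- of `u` is zero.
    have hparts := sum_gradient_mul hG hST hNT (f := fun x => f k x ^ 2 * u x)
      (fun x hx => by simp [hf k x hx]) u
    have hzero : ∑ x ∈ S k, f k x ^ 2 * u x * ∑ y ∈ (hG x).toFinset, (u x - u y) = 0 := by
      refine Finset.sum_eq_zero fun x _ => ?_
      by_cases hx : u x = 0
      · simp [hx]
      · rw [hu x hx, mul_zero]
    have hen := sum_gradient_sq_le hG T (hf k)
    calc _ ≤ ∑ p ∈ T ×ˢ T, adjWeight G p *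
          ((u p.1 - u p.2) ^ 2 * (f k p.1 ^ 2 + f k p.2 ^ 2) / 4) :=
          Finset.sum_le_sum_of_subset_of_nonneg (Finset.product_subset_product hFT hFT)
            fun p _ _ => mul_nonneg (adjWeight_nonneg p) (by positivity)
      _ ≤ ∑ p ∈ T ×ˢ T, (adjWeight G p * ((u p.1 - u p.2) *
            (f k p.1 ^ 2 * u p.1 - f k p.2 ^ 2 * u p.2)) +
            2 * (adjWeight G p * (f k p.1 - f k p.2) ^ 2)) := by
          refine Finset.sum_le_sum fun p _ => ?_
          have := mul_le_mul_of_nonneg_left (caccioppoli_pointwise (u0 p.1) (u1 p.1) (u0 p.2)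
            (u1 p.2) (f k p.1) (f k p.2)) (adjWeight_nonneg (G := G) p)
          linarith
      _ ≤ 4 * K := by
          rw [Finset.sum_add_distrib, ← Finset.mul_sum, hparts, hzero]
          linarith [hK k]
  have hlim := tendsto_finsetSum (F ×ˢ F) fun p _ =>
    ((((tendsto_cutoff hone p.1).pow 2).add ((tendsto_cutoff hone p.2).pow 2)).const_mul
      ((u p.1 - u p.2) ^ 2) |>.div_const 4).const_mul (adjWeight G p)
  have h := le_of_tendsto' hlim hbound
  have heq : ∑ p ∈ F ×ˢ F, adjWeight G p * ((u p.1 - u p.2) ^ 2 * (1 ^ 2 + 1 ^ 2) / 4)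
      = (∑ p ∈ F ×ˢ F, adjWeight G p * (u p.1 - u p.2) ^ 2) / 2 := by
    rw [Finset.sum_div]
    exact Finset.sum_congr rfl fun p _ => by ring
  linarith

/-- A function with values in `[0, 1]` that vanishes at `o` and is harmonic elsewhere is harmonic
at `o` as well. -/
theorem sum_neighbors_eq_zero_of_cutoff {ρ : V} {K : ℝ} (hcut : ∀ k, HasCutoff G hG ρ K k)
    {u : V → ℝ} (u0 : 0 ≤ u) (u1 : ∀ x, u x ≤ 1) {o : V} (ho : u o = 0)
    (hu : ∀ x, x ≠ o → ∑ y ∈ (hG x).toFinset, (u x - u y) = 0) :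
    ∑ y ∈ (hG o).toFinset, u y = 0 := by
  classical
  have henergy := energy_le_of_cutoff hG hcut u0 u1 fun x hx => hu x fun h => hx (h ▸ ho)
  choose S f hf hone hK using hcut
  have hK0 : 0 ≤ K := le_trans (Finset.sum_nonneg fun x _ => Finset.sum_nonneg fun y _ =>
    sq_nonneg _) (hK 0)
  set e : V × V → ℝ := fun p => adjWeight G p * (u p.1 - u p.2) ^ 2 with he
  have he0 : 0 ≤ e := fun p => mul_nonneg (adjWeight_nonneg p) (sq_nonneg _)
  have hsub : ∀ s : Finset (V × V), ∃ F : Finset V, s ⊆ F ×ˢ F := fun s =>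
    ⟨s.image Prod.fst ∪ s.image Prod.snd, fun p hp => Finset.mem_product.2
      ⟨Finset.mem_union_left _ (Finset.mem_image_of_mem _ hp),
        Finset.mem_union_right _ (Finset.mem_image_of_mem _ hp)⟩⟩
  have hsum : Summable e := summable_of_sum_le he0 fun s => by
    obtain ⟨F, hF⟩ := hsub s
    exact (Finset.sum_le_sum_of_subset_of_nonneg hF fun p _ _ => he0 p).trans (henergy F)
  set m := ∑ y ∈ (hG o).toFinset, u y with hm
  have hm0 : 0 ≤ m := Finset.sum_nonneg fun y _ => u0 y
  have hmain : ∀ t : ℝ, 0 < t → 2 * m ≤ t / 2 + t * K := by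
    intro t ht
    obtain ⟨s, hs⟩ := summable_iff_vanishing_norm.1 hsum (t ^ 2) (by positivity)
    obtain ⟨F, hF⟩ := hsub s
    -- On the fixed finite set `F ×ˢ F` the gradient of `f k` tends to zero with `k`. Off it the
    -- energy of `u` is below `t ^ 2`, and the weighted inequality `a * b ≤ a ^ 2 / (2 * t) + t * b
    -- ^ 2 / 2` gives an error `t / 2 + t * K` uniform in `k`.
    have hk : ∀ k, f k o * (2 * m) ≤ ∑ p ∈ F ×ˢ F, |adjWeight G p *
        ((u p.1 - u p.2) * (f k p.1 - f k p.2))| + (t / 2 + t * K) := by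
      intro k
      set T := F ∪ (S k ∪ (S k).biUnion fun x => (hG x).toFinset)
      have hFT : F ⊆ T := Finset.subset_union_left
      have hST : S k ⊆ T := Finset.subset_union_left.trans Finset.subset_union_right
      have hNT : ∀ x ∈ S k, (hG x).toFinset ⊆ T := fun x hx =>
        (Finset.subset_biUnion_of_mem (fun x => (hG x).toFinset) hx).trans
          (Finset.subset_union_right.trans Finset.subset_union_right)
      have hparts := sum_gradient_mul hG hST hNT (hf k) u
      have hlap : ∑ x ∈ S k, f k x * ∑ y ∈ (hG x).toFinset, (u x - u y) = - (f k o * m) := by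
        rw [Finset.sum_eq_single o]
        · simp [ho, hm]
        · intro x _ hx
          rw [hu x hx, mul_zero]
        · intro h
          simp [hf k o h]
      rw [hlap] at hparts
      have hen := (sum_gradient_sq_le hG T (hf k)).trans
        (mul_le_mul_of_nonneg_left (hK k) zero_le_two)
      have htail := hs ((T ×ˢ T) \ (F ×ˢ F))
        (Finset.sdiff_disjoint.mono_right hF)
      rw [Real.norm_of_nonneg (Finset.sum_nonneg fun p _ => he0 p)] at htail
      have hFT2 := Finset.product_subset_product hFT hFT
      have hrest : ∑ p ∈ (T ×ˢ T) \ (F ×ˢ F), |adjWeight G p *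
          ((u p.1 - u p.2) * (f k p.1 - f k p.2))| ≤ t / 2 + t * K := by
        calc _ ≤ ∑ p ∈ (T ×ˢ T) \ (F ×ˢ F), (1 / (2 * t) * e p +
                t / 2 * (adjWeight G p * (f k p.1 - f k p.2) ^ 2)) := by
              refine Finset.sum_le_sum fun p _ => ?_
              rw [abs_mul, abs_of_nonneg (adjWeight_nonneg p)]
              have : |(u p.1 - u p.2) * (f k p.1 - f k p.2)|
                  ≤ 1 / (2 * t) * (u p.1 - u p.2) ^ 2 + t / 2 * (f k p.1 - f k p.2) ^ 2 := by
                have h2 : ∀ a b : ℝ, a * b ≤ 1 / (2 * t) * a ^ 2 + t / 2 * b ^ 2 := by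
                  intro a b
                  have : 1 / (2 * t) * a ^ 2 + t / 2 * b ^ 2 - a * b
                      = (a - t * b) ^ 2 / (2 * t) := by field_simp; ring
                  have h3 : 0 ≤ (a - t * b) ^ 2 / (2 * t) := by positivity
                  linarith
                rw [abs_mul]
                simpa using h2 |u p.1 - u p.2| |f k p.1 - f k p.2|
              have := mul_le_mul_of_nonneg_left this (adjWeight_nonneg (G := G) p)
              simp only [he]
              linarith
          _ ≤ 1 / (2 * t) * t ^ 2 + t / 2 * (2 * K) := by
              rw [Finset.sum_add_distrib, ← Finset.mul_sum, ← Finset.mul_sum]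
              gcongr
              refine le_trans ?_ hen
              exact Finset.sum_le_sum_of_subset_of_nonneg Finset.sdiff_subset fun p _ _ =>
                mul_nonneg (adjWeight_nonneg p) (sq_nonneg _)
          _ = t / 2 + t * K := by field_simp
      have habs := Finset.abs_sum_le_sum_abs (fun p => adjWeight G p *
          ((u p.1 - u p.2) * (f k p.1 - f k p.2))) (T ×ˢ T)
      rw [hparts, ← Finset.sum_sdiff hFT2] at habs
      have := neg_abs_le (2 * -(f k o * m))
      linarith
    have hl1 := (tendsto_cutoff hone o).mul_const (2 * m)
    have hl2 := (tendsto_finsetSum (F ×ˢ F) fun p _ =>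
      ((((tendsto_cutoff hone p.1).sub (tendsto_cutoff hone p.2)).const_mul
        (u p.1 - u p.2)).const_mul (adjWeight G p)).abs).add_const (t / 2 + t * K)
    have := le_of_tendsto_of_tendsto' hl1 hl2 hk
    simpa using this
  have hlim : Tendsto (fun t : ℝ => t / 2 + t * K) (𝓝[>] 0) (𝓝 (0 / 2 + 0 * K)) :=
    (((continuous_id.div_const 2).add (continuous_id.mul continuous_const)).tendsto 0).mono_left
      nhdsWithin_le_nhds
  have := ge_of_tendsto hlim (eventually_nhdsWithin_of_forall hmain)
  linarith

/-- A graph with finitely supported functions of bounded energy that tend to `1` is recurrent. -/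
theorem isRecurrent_of_cutoff {ρ : V} {K : ℝ} (hcut : ∀ k, HasCutoff G hG ρ K k) :
    IsRecurrent G hG := by
  classical
  refine isRecurrent_of_avoidLim_eq_zero hG fun x => ?_
  -- Setting the value at `x` to `0` makes `u` harmonic off `x`, while the one-step average of `u`
  -- at `x` is the escape probability `avoidLim hG x x`.
  set u : V → ℝ := Set.indicator {x}ᶜ (avoidLim hG x) with hu
  have u0 : 0 ≤ u := Set.indicator_nonneg fun y _ => avoidLim_nonneg hG x y
  have u1 : ∀ y, u y ≤ 1 := fun y => Set.indicator_apply_le' (fun _ => avoidLim_le_one hG x y)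
    fun _ => zero_le_one
  have ux : u x = 0 := by simp [hu]
  have hharm : ∀ y, y ≠ x → ∑ z ∈ (hG y).toFinset, (u y - u z) = 0 := by
    intro y hy
    have h : u y = walkAvg hG u y := by
      rw [← avoidLim_eq hG x y]
      simp [hu, hy]
    unfold walkAvg at h
    split_ifs at h with hne
    · have : ((hG y).toFinset.card : ℝ) ≠ 0 := by simpa using hne.card_pos.ne'
      rw [Finset.sum_sub_distrib, Finset.sum_const, nsmul_eq_mul]
      field_simp at h
      linarith
    · rw [Finset.not_nonempty_iff_eq_empty.1 hne, Finset.sum_empty]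
  have hzero := sum_neighbors_eq_zero_of_cutoff hG hcut u0 u1 ux hharm
  rw [avoidLim_eq hG x x, ← hu]
  unfold walkAvg
  split_ifs
  · rw [hzero, zero_div]
  · exact ux

end Dirichlet

/-! ## Local isomorphisms -/

namespace RootedNetwork

variable {M : Type}

/-- `φ` restricts to an isomorphism of the `r`-balls at the roots that changes marks by at most
`1 / r`. -/
structure IsLocalIso [PseudoMetricSpace M] (r : ℝ≥0) (X Y : RootedNetwork M) (φ : X.V → Y.V) :
    Prop where
  map_root : φ X.root = Y.root
  injOn : Set.InjOn φ (X.ball r)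
  adj_iff : ∀ u ∈ X.ball r, ∀ v ∈ X.ball r, (Y.graph.Adj (φ u) (φ v) ↔ X.graph.Adj u v)
  exists_eq : ∀ y ∈ Y.ball r, ∃ x ∈ X.ball r, φ x = y
  dist_mark_le : ∀ v ∈ X.ball r, dist (X.mark v) (Y.mark (φ v)) ≤ 1 / (r : ℝ)

variable {X Y : RootedNetwork M} {r : ℝ≥0}

theorem mem_ball_iff {v : X.V} : v ∈ X.ball r ↔ (X.graph.dist X.root v : ℝ≥0) ≤ r := Iff.rfl

theorem root_mem_ball : X.root ∈ X.ball r := by simp [mem_ball_iff]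

theorem mem_ball_of_length_le {v : X.V} (p : X.graph.Walk v X.root) (h : (p.length : ℝ≥0) ≤ r) :
    v ∈ X.ball r := by
  rw [mem_ball_iff, SimpleGraph.dist_comm]
  exact (Nat.cast_le.2 (SimpleGraph.dist_le p)).trans h

theorem exists_forall_mem_ball (X : RootedNetwork M) (v : X.V) : ∃ r₀ : ℝ≥0, ∀ r ≥ r₀, v ∈ X.ball r :=
  ⟨X.graph.dist X.root v, fun _ hr => hr⟩

open Classical in
/-- The extension by the root of an isomorphism of balls. -/
def extendBallIso (ψ : X.ballGraph r ≃g Y.ballGraph r) (v : X.V) : Y.V :=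
  if h : v ∈ X.ball r then ψ ⟨v, h⟩ else Y.root

theorem extendBallIso_apply (ψ : X.ballGraph r ≃g Y.ballGraph r) (v : X.V) (h : v ∈ X.ball r) :
    extendBallIso ψ v = ψ ⟨v, h⟩ := dif_pos h

variable [PseudoMetricSpace M]

theorem isLocalIso_extendBallIso (ψ : X.ballGraph r ≃g Y.ballGraph r)
    (hroot : ∀ v : X.ball r, (ψ v : Y.V) = Y.root ↔ (v : X.V) = X.root)
    (hmark : ∀ v : X.ball r, dist (X.mark v) (Y.mark (ψ v)) ≤ 1 / (r : ℝ)) :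
    IsLocalIso r X Y (extendBallIso ψ) where
  map_root := by
    rw [extendBallIso_apply ψ _ root_mem_ball]
    exact (hroot ⟨X.root, root_mem_ball⟩).2 rfl
  injOn := by
    intro u hu v hv h
    rw [extendBallIso_apply ψ u hu, extendBallIso_apply ψ v hv] at h
    exact congrArg Subtype.val (ψ.injective (Subtype.ext h))
  adj_iff := by
    intro u hu v hv
    rw [extendBallIso_apply ψ u hu, extendBallIso_apply ψ v hv]
    exact ψ.map_rel_iff (a := ⟨u, hu⟩) (b := ⟨v, hv⟩)
  exists_eq := by
    intro y hy
    refine ⟨ψ.symm ⟨y, hy⟩, (ψ.symm ⟨y, hy⟩).2, ?_⟩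
    rw [extendBallIso_apply ψ _ (ψ.symm ⟨y, hy⟩).2]
    simp
  dist_mark_le := by
    intro v hv
    rw [extendBallIso_apply ψ v hv]
    exact hmark ⟨v, hv⟩

namespace IsLocalIso

variable {φ : X.V → Y.V}

/-- A geodesic to the root stays inside the ball, so its edges are preserved one by one. -/
theorem dist_le (h : IsLocalIso r X Y φ) {x : X.V} (hx : x ∈ X.ball r) :
    Y.graph.dist Y.root (φ x) ≤ X.graph.dist X.root x := by
  have key : ∀ {u v : X.V} (p : X.graph.Walk u v), v = X.root → (p.length : ℝ≥0) ≤ r →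
      Y.graph.dist Y.root (φ u) ≤ p.length := by
    intro u v p
    induction p with
    | nil =>
      rintro rfl _
      simp [h.map_root]
    | @cons u w v a q ih =>
      rintro rfl hr
      have hq : (q.length : ℝ≥0) ≤ r := le_trans (by simp) hr
      have hadj := (h.adj_iff w (mem_ball_of_length_le q hq) u
        (mem_ball_of_length_le (SimpleGraph.Walk.cons a q) hr)).2 a.symm
      have := Y.connected.dist_triangle (u := Y.root) (v := φ w) (w := φ u)
      rw [SimpleGraph.dist_eq_one_iff_adj.2 hadj] at this
      rw [SimpleGraph.Walk.length_cons]
      exact this.trans (Nat.add_le_add_right (ih rfl hq) 1)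
  obtain ⟨p, hp⟩ := X.connected.exists_walk_length_eq_dist x X.root
  rw [SimpleGraph.dist_comm (u := X.root), ← hp]
  refine key p rfl ?_
  rw [hp, SimpleGraph.dist_comm]
  exact hx

/-- A geodesic in `Y` stays inside the ball and is lifted vertex by vertex, starting at the root. -/
theorem exists_dist_le (h : IsLocalIso r X Y φ) {y : Y.V} (hy : y ∈ Y.ball r) :
    ∃ x, φ x = y ∧ X.graph.dist X.root x ≤ Y.graph.dist Y.root y := by
  have key : ∀ {u v : Y.V} (p : Y.graph.Walk u v), v = Y.root → (p.length : ℝ≥0) ≤ r →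
      ∃ x ∈ X.ball r, φ x = u ∧ X.graph.dist X.root x ≤ p.length := by
    intro u v p
    induction p with
    | nil =>
      rintro rfl _
      exact ⟨X.root, root_mem_ball, h.map_root, by simp⟩
    | @cons u w v a q ih =>
      rintro rfl hr
      have hq : (q.length : ℝ≥0) ≤ r := le_trans (by simp) hr
      obtain ⟨z, hz, rfl, hzd⟩ := ih rfl hq
      obtain ⟨x, hx, rfl⟩ := h.exists_eq u (mem_ball_of_length_le (SimpleGraph.Walk.cons a q) hr)
      refine ⟨x, hx, rfl, ?_⟩
      have hadj := (h.adj_iff z hz x hx).1 a.symm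
      have := X.connected.dist_triangle (u := X.root) (v := z) (w := x)
      rw [SimpleGraph.dist_eq_one_iff_adj.2 hadj] at this
      rw [SimpleGraph.Walk.length_cons]
      exact this.trans (Nat.add_le_add_right hzd 1)
  obtain ⟨p, hp⟩ := Y.connected.exists_walk_length_eq_dist y Y.root
  obtain ⟨x, -, hxy, hx⟩ := key p rfl (by rw [hp, SimpleGraph.dist_comm]; exact hy)
  refine ⟨x, hxy, hx.trans ?_⟩
  rw [hp, SimpleGraph.dist_comm]

end IsLocalIso

/-- The filter of local isomorphisms from `X` at large radii. -/
def near (X : RootedNetwork M) : Filter ((Y : RootedNetwork M) × (X.V → Y.V)) where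
  sets := {s | ∃ r₀ : ℝ≥0, ∀ r ≥ r₀, ∀ p, IsLocalIso r X p.1 p.2 → p ∈ s}
  univ_sets := ⟨0, fun _ _ _ _ => trivial⟩
  sets_of_superset := by
    rintro s t ⟨r₀, h⟩ hst
    exact ⟨r₀, fun r hr p hp => hst (h r hr p hp)⟩
  inter_sets := by
    rintro s t ⟨r₁, h₁⟩ ⟨r₂, h₂⟩
    exact ⟨max r₁ r₂, fun r hr p hp =>
      ⟨h₁ r (le_of_max_le_left hr) p hp, h₂ r (le_of_max_le_right hr) p hp⟩⟩

theorem eventually_near {P : (Y : RootedNetwork M) × (X.V → Y.V) → Prop} :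
    (∀ᶠ p in X.near, P p) ↔
      ∃ r₀ : ℝ≥0, ∀ r ≥ r₀, ∀ (Y : RootedNetwork M) (φ : X.V → Y.V), IsLocalIso r X Y φ →
        P ⟨Y, φ⟩ :=
  ⟨fun ⟨r₀, h⟩ => ⟨r₀, fun r hr Y φ hφ => h r hr ⟨Y, φ⟩ hφ⟩,
    fun ⟨r₀, h⟩ => ⟨r₀, fun r hr p hp => h r hr p.1 p.2 hp⟩⟩

/-- The supremum in `locDist` only yields agreement at some radius beyond `r₀`, which is why `near`
quantifies over all large radii. -/
theorem exists_agree_of_locDist_lt {r₀ : ℝ≥0}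
    (h : locDist X Y < (1 + (r₀ : ℝ≥0∞))⁻¹) : ∃ r ≥ r₀, Agree r X Y := by
  rw [locDist, ENNReal.inv_lt_inv, ENNReal.add_lt_add_iff_left ENNReal.one_ne_top] at h
  obtain ⟨r, hr⟩ := lt_iSup_iff.1 h
  obtain ⟨h2, hr⟩ := lt_iSup_iff.1 hr
  exact ⟨r, by exact_mod_cast hr.le, h2.2⟩

theorem isOpen_of_eventually_near {U : Set (RootedNetwork M)}
    (hU : ∀ X ∈ U, ∀ᶠ p in X.near, p.1 ∈ U) : IsOpen U := by
  intro X hX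
  obtain ⟨r₀, h⟩ := eventually_near.1 (hU X hX)
  refine ⟨(1 + (r₀ : ℝ≥0∞))⁻¹, by simp [ENNReal.add_eq_top], fun Y hY => ?_⟩
  obtain ⟨r, hr, ψ, h1, h2⟩ := exists_agree_of_locDist_lt hY
  exact h r hr Y _ (isLocalIso_extendBallIso ψ h1 h2)

theorem eventually_near_adj_iff (u v : X.V) :
    ∀ᶠ p in X.near, (p.1.graph.Adj (p.2 u) (p.2 v) ↔ X.graph.Adj u v) := by
  obtain ⟨r₁, h₁⟩ := X.exists_forall_mem_ball u
  obtain ⟨r₂, h₂⟩ := X.exists_forall_mem_ball v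
  exact eventually_near.2 ⟨max r₁ r₂, fun r hr Y φ hφ =>
    hφ.adj_iff u (h₁ r (le_of_max_le_left hr)) v (h₂ r (le_of_max_le_right hr))⟩

theorem eventually_near_injOn (S : Finset X.V) : ∀ᶠ p in X.near, Set.InjOn p.2 (S : Set X.V) := by
  have h : ∀ u ∈ S, ∀ v ∈ S, ∀ᶠ p in X.near, p.2 u = p.2 v → u = v := by
    intro u _ v _
    obtain ⟨r₁, h₁⟩ := X.exists_forall_mem_ball u
    obtain ⟨r₂, h₂⟩ := X.exists_forall_mem_ball v
    exact eventually_near.2 ⟨max r₁ r₂, fun r hr Y φ hφ =>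
      hφ.injOn (h₁ r (le_of_max_le_left hr)) (h₂ r (le_of_max_le_right hr))⟩
  have h2 := (Filter.eventually_all_finset S).2 fun u hu =>
    (Filter.eventually_all_finset S).2 (h u hu)
  filter_upwards [h2] with p hp u hu v hv using hp u hu v hv

theorem tendsto_mark_near (v : X.V) :
    Tendsto (fun p => p.1.mark (p.2 v)) X.near (𝓝 (X.mark v)) := by
  rw [Metric.tendsto_nhds]
  intro ε hε
  obtain ⟨r₁, h₁⟩ := X.exists_forall_mem_ball v
  refine eventually_near.2 ⟨max r₁ (2 / ε).toNNReal, fun r hr Y φ hφ => ?_⟩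
  have h := hφ.dist_mark_le v (h₁ r (le_of_max_le_left hr))
  rw [dist_comm]
  refine h.trans_lt ?_
  have hr2 : 2 / ε ≤ r := Real.toNNReal_le_iff_le_coe.1 (le_of_max_le_right hr)
  have : 0 < 2 / ε := by positivity
  rw [div_lt_iff₀ (by linarith)]
  calc (1 : ℝ) < 2 / ε * ε := by rw [div_mul_cancel₀ _ hε.ne']; norm_num
    _ ≤ r * ε := by gcongr
    _ = ε * r := mul_comm _ _

theorem eventually_near_dist_le (k : ℕ) :
    ∀ᶠ p in X.near, ∀ y, p.1.graph.dist p.1.root y ≤ k →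
      ∃ x, X.graph.dist X.root x ≤ k ∧ p.2 x = y := by
  refine eventually_near.2 ⟨k, fun r hr Y φ hφ y hy => ?_⟩
  obtain ⟨x, hx, hd⟩ := hφ.exists_dist_le (y := y) (le_trans (Nat.cast_le.2 hy) hr)
  exact ⟨x, hd.trans hy, hx⟩

theorem eventually_near_neighborSet (v : X.V) :
    ∀ᶠ p in X.near, p.1.graph.neighborSet (p.2 v) = p.2 '' X.graph.neighborSet v := by
  -- The extra `1` puts all neighbors of `v` and of `φ v` inside the balls.
  refine eventually_near.2 ⟨(X.graph.dist X.root v : ℝ≥0) + 1, fun r hr Y φ hφ => ?_⟩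
  have hv : v ∈ X.ball r := le_trans (by simp) hr
  have hnb : ∀ {w : X.V}, X.graph.Adj v w → w ∈ X.ball r := by
    intro w hw
    refine le_trans ?_ hr
    have := X.connected.dist_triangle (u := X.root) (v := v) (w := w)
    rw [SimpleGraph.dist_eq_one_iff_adj.2 hw] at this
    exact_mod_cast this
  ext y
  simp only [SimpleGraph.mem_neighborSet, Set.mem_image]
  constructor
  · intro hy
    have hyr : y ∈ Y.ball r := by
      refine le_trans ?_ hr
      have h1 := Y.connected.dist_triangle (u := Y.root) (v := φ v) (w := y)
      rw [SimpleGraph.dist_eq_one_iff_adj.2 hy] at h1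
      have h2 := hφ.dist_le hv
      exact_mod_cast h1.trans (Nat.add_le_add_right h2 1)
    obtain ⟨x, hx, rfl⟩ := hφ.exists_eq y hyr
    exact ⟨x, (hφ.adj_iff v hv x hx).1 hy, rfl⟩
  · rintro ⟨w, hw, rfl⟩
    exact (hφ.adj_iff v hv w (hnb hw)).2 hw

theorem eventually_near_cutoff {K : ℝ} {k : ℕ}
    (h : HasCutoff X.graph X.locallyFinite X.root K k) :
    ∀ᶠ p in X.near, HasCutoff p.1.graph p.1.locallyFinite p.1.root K k := by
  classical
  obtain ⟨S, f, hf, hone, hK⟩ := h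
  filter_upwards [eventually_near_injOn (S ∪ S.biUnion fun x => (X.locallyFinite x).toFinset),
    eventually_near_dist_le k,
    (Filter.eventually_all_finset S).2 fun v _ => eventually_near_neighborSet v] with ⟨Y, φ⟩
    hinj hdist hnb
  dsimp only at hinj hdist hnb ⊢
  set T := S ∪ S.biUnion fun x => (X.locallyFinite x).toFinset with hT
  have hST : S ⊆ T := Finset.subset_union_left
  have hNT : ∀ x ∈ S, (X.locallyFinite x).toFinset ⊆ T := fun x hx =>
    (Finset.subset_biUnion_of_mem (fun x => (X.locallyFinite x).toFinset) hx).trans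
      Finset.subset_union_right
  -- The map is injective on `T` but arbitrary far away, so `f` is pushed forward from `S` only; on
  -- the image of `T` this sum has at most one term.
  set g : Y.V → ℝ := fun y => ∑ x ∈ S, if φ x = y then f x else 0 with hg
  have hgf : ∀ x ∈ T, g (φ x) = f x := by
    intro x hx
    have : ∀ z ∈ S, (if φ z = φ x then f z else 0) = if z = x then f z else 0 := by
      intro z hz
      simp only [hinj.eq_iff (hST hz) hx]
    rw [hg]
    simp only
    rw [Finset.sum_congr rfl this, Finset.sum_ite_eq']
    split_ifs with hxS
    · rfl
    · exact (hf x hxS).symm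
  refine ⟨S.image φ, g, ?_, ?_, ?_⟩
  · intro y hy
    refine Finset.sum_eq_zero fun x hx => if_neg ?_
    rintro rfl
    exact hy (Finset.mem_image_of_mem _ hx)
  · intro y hy
    obtain ⟨x, hx, rfl⟩ := hdist y hy
    -- Membership in `S` must be part of `HasCutoff`: for `k = 0` the bound on `1 - f x` allows `f x
    -- = 0`.
    obtain ⟨hxS, hx1⟩ := hone x hx
    rw [hgf x (hST hxS)]
    exact ⟨Finset.mem_image_of_mem _ hxS, hx1⟩
  · refine le_trans (le_of_eq ?_) hK
    rw [Finset.sum_image (hinj.mono hST)]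
    refine Finset.sum_congr rfl fun x hx => ?_
    have : (Y.locallyFinite (φ x)).toFinset = (X.locallyFinite x).toFinset.image φ := by
      ext y
      rw [Set.Finite.mem_toFinset, hnb x hx]
      simp
    rw [this, Finset.sum_image (hinj.mono (hNT x hx))]
    refine Finset.sum_congr rfl fun z hz => ?_
    rw [hgf x (hST hx), hgf z (hNT x hx hz)]

theorem isOpen_setOf_hasCutoff (K : ℝ) (k : ℕ) :
    IsOpen {X : RootedNetwork M | HasCutoff X.graph X.locallyFinite X.root K k} :=
  isOpen_of_eventually_near fun _ hX => eventually_near_cutoff hX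

end RootedNetwork

/-! ## Lower semicontinuous functionals of doubly-rooted networks -/

/-- Truncation at the limit value turns a lower semicontinuity bound into convergence, so that limit
theorems for finite sums apply. -/
theorem tendsto_min_of_forall_lt {α : Type*} {l : Filter α} {f : α → ℝ≥0∞} {a : ℝ≥0∞}
    (h : ∀ c < a, ∀ᶠ p in l, c < f p) : Tendsto (fun p => min (f p) a) l (𝓝 a) := by
  refine tendsto_order.2 ⟨fun c hc => ?_, fun c hc => ?_⟩
  · filter_upwards [h c hc] with p hp using lt_min hp hc
  · exact Eventually.of_forall fun p => (min_le_right _ _).trans_lt hc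

theorem eventually_lt_sum {α ι : Type*} {l : Filter α} {S : Finset ι} {f : ι → α → ℝ≥0∞}
    {a : ι → ℝ≥0∞} (h : ∀ i ∈ S, ∀ c < a i, ∀ᶠ p in l, c < f i p) {c : ℝ≥0∞}
    (hc : c < ∑ i ∈ S, a i) : ∀ᶠ p in l, c < ∑ i ∈ S, f i p := by
  have hlim := tendsto_finsetSum S fun i hi => tendsto_min_of_forall_lt (h i hi)
  filter_upwards [hlim.eventually_const_lt hc] with p hp
  exact hp.trans_le (Finset.sum_le_sum fun i _ => min_le_left _ _)

/-- A functional of doubly-rooted networks that is lower semicontinuous for the local topology. -/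
def LocallyLowerSemicontinuous {M : Type} [PseudoMetricSpace M]
    (H : ∀ {V : Type}, SimpleGraph V → (V → M) → V → V → ℝ≥0∞) : Prop :=
  ∀ (X : RootedNetwork M) (a b : X.V) (c : ℝ≥0∞), c < H X.graph X.mark a b →
    ∀ᶠ p in X.near, c < H p.1.graph p.1.mark (p.2 a) (p.2 b)

namespace LocallyLowerSemicontinuous

variable {M : Type} [PseudoMetricSpace M]
  {H : ∀ {V : Type}, SimpleGraph V → (V → M) → V → V → ℝ≥0∞}

/-- A finite partial sum already exceeds `c`, and since the local isomorphism is injective on its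
index set, the transported terms form a partial sum in the nearby network. -/
theorem eventually_lt_tsum (hH : LocallyLowerSemicontinuous H) (X : RootedNetwork M) (a : X.V)
    (c : ℝ≥0∞) (hc : c < ∑' x, H X.graph X.mark a x) :
    ∀ᶠ p in X.near, c < ∑' x, H p.1.graph p.1.mark (p.2 a) x := by
  classical
  rw [ENNReal.tsum_eq_iSup_sum] at hc
  obtain ⟨S, hS⟩ := lt_iSup_iff.1 hc
  filter_upwards [eventually_lt_sum (fun x _ c hc => hH X a x c hc) hS,
    RootedNetwork.eventually_near_injOn S] with p hp hinj
  refine hp.trans_le ?_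
  rw [← Finset.sum_image (f := fun y => H p.1.graph p.1.mark (p.2 a) y) hinj]
  exact ENNReal.sum_le_tsum _

theorem measurable_tsum (hH : LocallyLowerSemicontinuous H) :
    Measurable fun X : RootedNetwork M => ∑' x, H X.graph X.mark X.root x := by
  refine measurable_of_Ioi fun c => IsOpen.measurableSet ?_
  refine RootedNetwork.isOpen_of_eventually_near fun X hX => ?_
  have hroot : ∀ᶠ p in X.near, p.2 X.root = p.1.root :=
    RootedNetwork.eventually_near.2 ⟨0, fun r _ Y φ hφ => hφ.map_root⟩
  filter_upwards [hH.eventually_lt_tsum X X.root c hX, hroot] with p hp hr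
  rwa [hr] at hp

theorem measurable_birooted (hH : LocallyLowerSemicontinuous H) :
    Measurable fun Z : BirootedNetwork M => H Z.graph Z.mark Z.root Z.root₂ := by
  refine measurable_of_Ioi fun c => IsOpen.measurableSet ?_
  intro Z hZ
  obtain ⟨r₁, h⟩ := RootedNetwork.eventually_near.1
    (hH Z.toRootedNetwork Z.root Z.root₂ c hZ)
  obtain ⟨r₂, h₂⟩ := Z.toRootedNetwork.exists_forall_mem_ball Z.root₂
  -- The radius `r₂` brings the second root into the ball, so that the isomorphism really maps it to
  -- the second root of `W`.
  refine ⟨(1 + ((max r₁ r₂ : ℝ≥0) : ℝ≥0∞))⁻¹, by simp [ENNReal.add_eq_top], fun W hW => ?_⟩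
  rw [BirootedNetwork.locDist, ENNReal.inv_lt_inv,
    ENNReal.add_lt_add_iff_left ENNReal.one_ne_top] at hW
  obtain ⟨r, hr⟩ := lt_iSup_iff.1 hW
  obtain ⟨⟨-, ψ, h3, h4, h5⟩, hr⟩ := lt_iSup_iff.1 hr
  have hr' : max r₁ r₂ ≤ r := by exact_mod_cast hr.le
  have hiso := RootedNetwork.isLocalIso_extendBallIso ψ h3 h5
  have hmem := h₂ r (le_of_max_le_right hr')
  have key := h r (le_of_max_le_left hr') W.toRootedNetwork _ hiso
  have e1 : RootedNetwork.extendBallIso ψ Z.root = W.root := hiso.map_root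
  have e2 : RootedNetwork.extendBallIso ψ Z.root₂ = W.root₂ := by
    rw [RootedNetwork.extendBallIso_apply ψ _ hmem]
    exact (h4 ⟨Z.root₂, hmem⟩).2 rfl
  simp only [e1, e2] at key
  exact key

theorem mass_transport (hH : LocallyLowerSemicontinuous H) {ν : Measure (RootedNetwork M)}
    (hν : IsUnimodular ν) :
    ∫⁻ X, ∑' x, H X.graph X.mark X.root x ∂ν = ∫⁻ X, ∑' x, H X.graph X.mark x X.root ∂ν :=
  hν.mass_transport _ hH.measurable_birooted

end LocallyLowerSemicontinuous

/-! ## The three functionals -/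

theorem confLength_cons {V : Type} {G : SimpleGraph V} (ω : V → ℝ≥0) {u v w : V} (h : G.Adj u v)
    (p : G.Walk v w) :
    confLength ω (SimpleGraph.Walk.cons h p) = (ω u + ω v) / 2 + confLength ω p := by
  simp [confLength]

theorem confLength_reverse {V : Type} {G : SimpleGraph V} (ω : V → ℝ≥0) {u v : V}
    (p : G.Walk u v) : confLength ω p.reverse = confLength ω p := by
  simp only [confLength, SimpleGraph.Walk.darts_reverse, List.map_map, List.map_reverse,
    List.sum_reverse]
  congr 1
  refine List.map_congr_left fun d _ => ?_
  simp [add_comm]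

theorem confDist_comm {V : Type} (G : SimpleGraph V) (ω : V → ℝ≥0) (u v : V) :
    confDist G ω u v = confDist G ω v u := by
  have h : ∀ u v, confDist G ω u v ≤ confDist G ω v u := fun u v => le_iInf fun p => by
    rw [← confLength_reverse]
    exact iInf_le _ p.reverse
  exact le_antisymm (h u v) (h v u)

/-- A walk uses finitely many edges and marks. Transporting it makes both the graph distance and the
conformal distance upper semicontinuous. -/
theorem eventually_near_walk {X : RootedConformalGraph} {a b : X.V} (w : X.graph.Walk a b)
    {c : ℝ≥0} (hc : confLength X.mark w < c) :
    ∀ᶠ p in X.near, ∃ q : p.1.graph.Walk (p.2 a) (p.2 b),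
      q.length = w.length ∧ confLength p.1.mark q < c := by
  induction w generalizing c with
  | nil => exact Eventually.of_forall fun p => ⟨SimpleGraph.Walk.nil, rfl, hc⟩
  | @cons u v w h q ih =>
    rw [confLength_cons, ← lt_tsub_iff_left] at hc
    obtain ⟨c', h1, h2⟩ := exists_between hc
    rw [lt_tsub_iff_right] at h2
    have hlim := (((RootedNetwork.tendsto_mark_near u).add
      (RootedNetwork.tendsto_mark_near v)).div_const 2).const_add c'
    filter_upwards [ih h1, hlim.eventually_lt_const h2, RootedNetwork.eventually_near_adj_iff u v]
      with p ⟨q', hq', hlen⟩ hlt hadj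
    refine ⟨SimpleGraph.Walk.cons (hadj.2 h) q', by simp [hq'], ?_⟩
    rw [confLength_cons]
    rw [add_comm] at hlt
    exact (add_lt_add_right hlen _).trans hlt

theorem eventually_near_dist_le_of_le {X : RootedConformalGraph} {a b : X.V} {k : ℕ}
    (h : X.graph.dist a b ≤ k) : ∀ᶠ p in X.near, p.1.graph.dist (p.2 a) (p.2 b) ≤ k := by
  obtain ⟨w, hw⟩ := X.connected.exists_walk_length_eq_dist a b
  filter_upwards [eventually_near_walk w (lt_add_one _)] with p ⟨q, hq, _⟩
  exact (SimpleGraph.dist_le q).trans (by omega)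

theorem eventually_near_confDist_lt {X : RootedConformalGraph} {a b : X.V} {R : ℝ≥0∞}
    (h : confDist X.graph X.mark a b < R) :
    ∀ᶠ p in X.near, confDist p.1.graph p.1.mark (p.2 a) (p.2 b) < R := by
  obtain ⟨w, hw⟩ := iInf_lt_iff.1 h
  obtain ⟨c, h1, h2⟩ := ENNReal.lt_iff_exists_nnreal_btwn.1 hw
  filter_upwards [eventually_near_walk w (ENNReal.coe_lt_coe.1 h1)] with p ⟨q, _, hq⟩
  exact (iInf_le _ q).trans_lt ((ENNReal.coe_lt_coe.2 hq).trans h2)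

open Classical in
/-- The indicator that the second root has degree larger than `D`. -/
def largeDegree (D : ℕ) {V : Type} (G : SimpleGraph V) (_ : V → ℝ≥0) (_ b : V) : ℝ≥0∞ :=
  if (D : ℕ∞) < (G.neighborSet b).encard then 1 else 0

open Classical in
/-- The squared mark of the second root, if it is within distance `k` of the first root. -/
def nearSquare (k : ℕ) {V : Type} (G : SimpleGraph V) (ω : V → ℝ≥0) (a b : V) : ℝ≥0∞ :=
  if G.dist a b ≤ k then (ω b : ℝ≥0∞) ^ 2 else 0

open Classical in
/-- The sum of the squared marks at and next to the second root, if it is within conformal distance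
less than `R` of the first root. -/
def confSquare (R : ℝ≥0∞) {V : Type} (G : SimpleGraph V) (ω : V → ℝ≥0) (a b : V) : ℝ≥0∞ :=
  if confDist G ω a b < R then ∑' y, nearSquare 1 G ω b y else 0

theorem locallyLowerSemicontinuous_largeDegree (D : ℕ) :
    LocallyLowerSemicontinuous (M := ℝ≥0) (largeDegree D) := by
  classical
  intro X a b c hc
  dsimp only [largeDegree] at hc ⊢
  split_ifs at hc with h
  · set S := (X.locallyFinite b).toFinset with hS
    have hcard : (X.graph.neighborSet b).encard = S.card := by
      rw [← Set.encard_coe_eq_coe_finsetCard, hS, Set.Finite.coe_toFinset]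
    filter_upwards [RootedNetwork.eventually_near_injOn S,
      (Filter.eventually_all_finset S).2 fun v _ => RootedNetwork.eventually_near_adj_iff b v]
      with p hinj hadj
    rw [if_pos]
    · exact hc
    · refine h.trans_le ?_
      rw [hcard, ← Finset.card_image_of_injOn hinj, ← Set.encard_coe_eq_coe_finsetCard]
      refine Set.encard_le_encard fun y hy => ?_
      obtain ⟨v, hv, rfl⟩ := Finset.mem_image.1 (Finset.mem_coe.1 hy)
      exact (hadj v hv).2 (by simpa [hS] using hv)
  · exact absurd hc not_lt_zero

theorem locallyLowerSemicontinuous_nearSquare (k : ℕ) :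
    LocallyLowerSemicontinuous (M := ℝ≥0) (nearSquare k) := by
  intro X a b c hc
  dsimp only [nearSquare] at hc ⊢
  split_ifs at hc with h
  · have hlim := ((ENNReal.continuous_pow 2).tendsto _).comp
      ((ENNReal.continuous_coe.tendsto _).comp (RootedNetwork.tendsto_mark_near b))
    filter_upwards [eventually_near_dist_le_of_le h, hlim.eventually_const_lt hc] with p h1 h2
    rw [if_pos h1]
    exact h2
  · exact absurd hc not_lt_zero

/-- The strict inequality in `confSquare` is what makes membership of the second root an open
condition. -/
theorem locallyLowerSemicontinuous_confSquare (R : ℝ≥0∞) :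
    LocallyLowerSemicontinuous (M := ℝ≥0) (confSquare R) := by
  intro X a b c hc
  dsimp only [confSquare] at hc ⊢
  split_ifs at hc with h
  · filter_upwards [eventually_near_confDist_lt h,
      (locallyLowerSemicontinuous_nearSquare 1).eventually_lt_tsum X b c hc] with p h1 h2
    rw [if_pos h1]
    exact h2
  · exact absurd hc not_lt_zero

/-! ## Consequences of the mass-transport principle -/

/-- What holds almost surely at the root holds at every vertex: by mass transport the expected
number of exceptional vertices is zero. -/
theorem ae_degree_le {ν : Measure RootedConformalGraph} (hν : IsUnimodular ν) {D : ℕ}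
    (h : ∀ᵐ X ∂ν, (X.graph.neighborSet X.root).encard ≤ (D : ℕ∞)) :
    ∀ᵐ X ∂ν, ∀ x, (X.graph.neighborSet x).encard ≤ (D : ℕ∞) := by
  have hH := locallyLowerSemicontinuous_largeDegree D
  have h0 : ∫⁻ X, ∑' x, largeDegree D X.graph X.mark x X.root ∂ν = 0 := by
    rw [lintegral_eq_zero_of_ae_eq_zero]
    filter_upwards [h] with X hX
    simp [largeDegree, not_lt.2 hX]
  rw [← hH.mass_transport hν, lintegral_eq_zero_iff hH.measurable_tsum] at h0
  filter_upwards [h0] with X hX x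
  have := ENNReal.tsum_eq_zero.1 hX x
  by_contra hx
  simp [largeDegree, not_le.1 hx] at this

theorem exists_finset_ball {V : Type} {G : SimpleGraph V} (hG : G.Connected)
    {D : ℕ} (hD : ∀ x, (G.neighborSet x).encard ≤ (D : ℕ∞)) (ρ : V) (k : ℕ) :
    ∃ B : Finset V, B.card ≤ (D + 1) ^ k ∧ ∀ x, G.dist x ρ ≤ k → x ∈ B := by
  classical
  have hfin : ∀ x, (G.neighborSet x).Finite := fun x =>
    Set.finite_of_encard_le_coe (hD x)
  induction k with
  | zero =>
    refine ⟨{ρ}, by simp, fun x hx => ?_⟩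
    simpa using (hG.dist_eq_zero_iff).1 (Nat.le_zero.1 hx)
  | succ k ih =>
    obtain ⟨B, hB, hmem⟩ := ih
    refine ⟨B.biUnion fun x => insert x (hfin x).toFinset, ?_, fun x hx => ?_⟩
    · rw [pow_succ]
      refine (Finset.card_biUnion_le_card_mul _ _ (D + 1) fun x _ => ?_).trans
        (Nat.mul_le_mul_right _ hB)
      refine (Finset.card_insert_le _ _).trans (Nat.add_le_add_right ?_ 1)
      have := hD x
      rw [(hfin x).encard_eq_coe_toFinset_card] at this
      exact_mod_cast this
    · obtain ⟨p, hp⟩ := hG.exists_walk_length_eq_dist x ρ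
      rw [← hp] at hx
      refine Finset.mem_biUnion.2 ?_
      cases p with
      | nil => exact ⟨ρ, hmem ρ (by simp), Finset.mem_insert_self _ _⟩
      | @cons _ v _ a q =>
        refine ⟨v, hmem v ((SimpleGraph.dist_le q).trans (by simpa using hx)), ?_⟩
        simp [a.symm]

theorem tsum_ite_const {V : Type} (P : V → Prop) [DecidablePred P] (c : ℝ≥0∞) :
    ∑' x, (if P x then c else 0) = ({x | P x}.encard : ℝ≥0∞) * c := by
  rw [← ENNReal.tsum_set_const, tsum_subtype {x | P x} fun _ => c]
  refine tsum_congr fun x => ?_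
  simp [Set.indicator_apply]

/-- After transport the root sends its own squared mark to each vertex within distance `k`, and
there are at most `(D + 1) ^ k` of these. -/
theorem lintegral_nearSquare_le {ν : Measure RootedConformalGraph} (hν : IsUnimodular ν) {D : ℕ}
    (hD : ∀ᵐ X ∂ν, ∀ x, (X.graph.neighborSet x).encard ≤ (D : ℕ∞))
    (hnorm : ∫⁻ X, (X.mark X.root : ℝ≥0∞) ^ 2 ∂ν = 1) (k : ℕ) :
    ∫⁻ X, ∑' x, nearSquare k X.graph X.mark X.root x ∂ν ≤ ((D + 1) ^ k : ℕ) := by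
  classical
  rw [(locallyLowerSemicontinuous_nearSquare k).mass_transport hν]
  calc _ ≤ ∫⁻ X, (((D + 1) ^ k : ℕ) : ℝ≥0∞) * (X.mark X.root : ℝ≥0∞) ^ 2 ∂ν := by
        refine lintegral_mono_ae ?_
        filter_upwards [hD] with X hX
        obtain ⟨B, hB, hmem⟩ := exists_finset_ball X.connected hX X.root k
        simp only [nearSquare]
        rw [tsum_ite_const]
        gcongr
        have h1 : {x | X.graph.dist x X.root ≤ k}.encard ≤ ((D + 1) ^ k : ℕ) := by
          refine (Set.encard_le_encard (t := (B : Set X.V)) fun x hx => hmem x hx).trans ?_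
          rw [Set.encard_coe_eq_coe_finsetCard]
          exact_mod_cast hB
        exact_mod_cast ENat.toENNReal_le.2 h1
    _ = ((D + 1) ^ k : ℕ) := by
        rw [lintegral_const_mul' _ _ (ENNReal.natCast_ne_top _), hnorm, mul_one]

/-- After transport every summand is the same quantity at the root, and by symmetry of `confDist`
the number of summands is at most the size of the conformal ball at the root. This is where the
uniform bound on ball sizes enters. -/
theorem lintegral_confSquare_le {ν : Measure RootedConformalGraph} (hν : IsUnimodular ν) {D : ℕ}
    (hD : ∀ᵐ X ∂ν, ∀ x, (X.graph.neighborSet x).encard ≤ (D : ℕ∞))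
    (hnorm : ∫⁻ X, (X.mark X.root : ℝ≥0∞) ^ 2 ∂ν = 1) {R : ℝ} {N : ℝ≥0∞} (hN : N ≠ ⊤)
    (hball : ∀ᵐ X ∂ν, ((confBall X.graph X.mark X.root R).encard : ℝ≥0∞) ≤ N) :
    ∫⁻ X, ∑' x, confSquare (ENNReal.ofReal R) X.graph X.mark X.root x ∂ν ≤ N * (D + 1 : ℕ) := by
  classical
  rw [(locallyLowerSemicontinuous_confSquare (ENNReal.ofReal R)).mass_transport hν]
  calc _ ≤ ∫⁻ X, N * ∑' y, nearSquare 1 X.graph X.mark X.root y ∂ν := by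
        refine lintegral_mono_ae ?_
        filter_upwards [hball] with X hX
        simp only [confSquare]
        rw [tsum_ite_const]
        gcongr
        refine le_trans (ENat.toENNReal_le.2 (Set.encard_le_encard fun x hx => ?_)) hX
        have : confDist X.graph X.mark x X.root < ENNReal.ofReal R := hx
        rw [confDist_comm] at this
        exact this.le
    _ ≤ N * (D + 1 : ℕ) := by
        rw [lintegral_const_mul' _ _ hN]
        gcongr
        simpa using lintegral_nearSquare_le hν hD hnorm 1

/-! ## Cutoff functions from conformal metrics -/

theorem confDist_ne_top {V : Type} {G : SimpleGraph V} (hG : G.Connected) (ω : V → ℝ≥0) (u v : V) :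
    confDist G ω u v ≠ ⊤ := by
  obtain ⟨p⟩ := hG.preconnected u v
  exact ((iInf_le _ p).trans_lt ENNReal.coe_lt_top).ne

theorem confDist_self {V : Type} (G : SimpleGraph V) (ω : V → ℝ≥0) (u : V) :
    confDist G ω u u = 0 :=
  le_antisymm ((iInf_le _ SimpleGraph.Walk.nil).trans (by simp [confLength])) (zero_le)

theorem confDist_toReal_le {V : Type} {G : SimpleGraph V} (hG : G.Connected) (ω : V → ℝ≥0)
    (o : V) {u v : V} (h : G.Adj u v) :
    (confDist G ω o u).toReal ≤ (confDist G ω o v).toReal + (ω u + ω v) / 2 := by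
  have key : confDist G ω o u ≤ ((ω u + ω v) / 2 : ℝ≥0) + confDist G ω o v := by
    rw [confDist_comm G ω o u, confDist_comm G ω o v]
    unfold confDist
    rw [ENNReal.add_iInf]
    refine le_iInf fun p => (iInf_le _ (SimpleGraph.Walk.cons h p)).trans ?_
    rw [confLength_cons, ENNReal.coe_add]
  have := ENNReal.toReal_mono
    (ENNReal.add_ne_top.2 ⟨ENNReal.coe_ne_top, confDist_ne_top hG ω o v⟩) key
  rw [ENNReal.toReal_add ENNReal.coe_ne_top (confDist_ne_top hG ω o v), add_comm,
    ENNReal.coe_toReal] at this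
  exact_mod_cast this

theorem confDist_toReal_le_mul {V : Type} {G : SimpleGraph V} (hG : G.Connected) (ω : V → ℝ≥0)
    (o : V) {k : ℕ} {c : ℝ} (hc : ∀ x, G.dist o x ≤ k → ω x ≤ c) :
    ∀ n ≤ k, ∀ x, G.dist o x = n → (confDist G ω o x).toReal ≤ n * c := by
  intro n
  induction n with
  | zero =>
    intro _ x hx
    obtain rfl := hG.dist_eq_zero_iff.1 hx
    simp [confDist_self]
  | succ n ih =>
    intro hn x hx
    obtain ⟨p, hp⟩ := hG.exists_walk_length_eq_dist x o
    rw [SimpleGraph.dist_comm, hx] at hp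
    cases p with
    | nil => simp at hp
    | @cons _ v _ a q =>
      have hq : q.length = n := by simpa using hp
      have h1 : G.dist o v ≤ n := by
        rw [SimpleGraph.dist_comm, ← hq]
        exact SimpleGraph.dist_le q
      have h2 := hG.dist_triangle (u := o) (v := v) (w := x)
      rw [SimpleGraph.dist_eq_one_iff_adj.2 a.symm] at h2
      have h3 := ih (by omega) v (by omega)
      have h4 := confDist_toReal_le hG ω o a
      have h5 := hc x (by omega)
      have h6 := hc v (by omega)
      push_cast
      linarith

/-- The cutoff is the conformal tent function of radius `R`. The first sum controls its energy. The
second forces ω to be at most `R / (k + 1) ^ 2` on the graph ball of radius `k`, so conformal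
distances there are at most `k * R / (k + 1) ^ 2`. -/
theorem hasCutoff_of_confSquare_le {V : Type} {G : SimpleGraph V} (hG : G.Connected)
    (hfin : ∀ v, (G.neighborSet v).Finite) {D : ℕ}
    (hD : ∀ x, (G.neighborSet x).encard ≤ (D : ℕ∞)) (ω : V → ℝ≥0) (o : V) {R t : ℝ} (hR : 0 < R)
    (ht : 0 ≤ t) (hball : (confBall G ω o R).Finite) (k : ℕ)
    (h1 : ∑' x, confSquare (ENNReal.ofReal R) G ω o x ≤ ENNReal.ofReal (t * R ^ 2))
    (h2 : ∑' x, nearSquare k G ω o x ≤ ENNReal.ofReal ((R / ((k : ℝ) + 1) ^ 2) ^ 2)) :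
    HasCutoff G hfin o ((D + 1) * t) k := by
  classical
  set d : V → ℝ := fun x => (confDist G ω o x).toReal with hd
  have hd0 : ∀ x, 0 ≤ d x := fun x => ENNReal.toReal_nonneg
  have hlt : ∀ x, confDist G ω o x < ENNReal.ofReal R ↔ d x < R := fun x =>
    ENNReal.lt_ofReal_iff_toReal_lt (confDist_ne_top hG ω o x)
  have hSfin : {x | d x < R}.Finite := hball.subset fun x hx => ((hlt x).2 hx).le
  set S := hSfin.toFinset with hS
  have hmem : ∀ x, x ∈ S ↔ d x < R := fun x => by simp [hS]
  set f : V → ℝ := fun x => max 0 (1 - d x / R) with hf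
  refine ⟨S, f, fun x hx => ?_, fun x hx => ?_, ?_⟩
  · rw [hmem, not_lt] at hx
    refine max_eq_left ?_
    have := (one_le_div hR).2 hx
    linarith
  · have hk : (0 : ℝ) < (k : ℝ) + 1 := by positivity
    have hc : ∀ y, G.dist o y ≤ k → (ω y : ℝ) ≤ R / ((k : ℝ) + 1) ^ 2 := by
      intro y hy
      have := (ENNReal.le_tsum y).trans h2
      rw [nearSquare, if_pos hy, ← ENNReal.coe_pow, ← ENNReal.ofReal_coe_nnreal,
        ENNReal.ofReal_le_ofReal_iff (by positivity)] at this
      push_cast at this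
      exact le_of_sq_le_sq this (by positivity)
    have hdx := confDist_toReal_le_mul hG ω o hc _ hx x rfl
    have hle : d x / R ≤ k / ((k : ℝ) + 1) ^ 2 := by
      rw [div_le_div_iff₀ hR (by positivity)]
      have : (G.dist o x : ℝ) * (R / ((k : ℝ) + 1) ^ 2) ≤ k * (R / ((k : ℝ) + 1) ^ 2) := by
        gcongr
      have h3 := hdx.trans this
      rw [← mul_div_assoc, le_div_iff₀ (by positivity)] at h3
      exact h3
    have h4 : (k : ℝ) / ((k : ℝ) + 1) ^ 2 ≤ 1 / ((k : ℝ) + 1) := by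
      rw [div_le_div_iff₀ (by positivity) hk]
      nlinarith
    -- Strictness is needed for membership in `S`; the bound `1 / (k + 1)` would not give it at `k =
    -- 0`.
    have h5 : (k : ℝ) / ((k : ℝ) + 1) ^ 2 < 1 := by
      rw [div_lt_one (by positivity)]
      nlinarith [Nat.cast_nonneg (α := ℝ) k]
    have h6 : d x / R < 1 := hle.trans_lt h5
    refine ⟨(hmem x).2 ((div_lt_one hR).1 h6), ?_⟩
    rw [hf]
    simp only
    rw [max_eq_right (by linarith), sub_sub_cancel,
      abs_of_nonneg (div_nonneg (hd0 x) hR.le)]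
    exact hle.trans h4
  · set I : V → Finset V := fun x => insert x (hfin x).toFinset with hI
    have hlip : ∀ x y, G.Adj x y → (f x - f y) ^ 2 ≤ ((ω x : ℝ) ^ 2 + (ω y) ^ 2) / 2 / R ^ 2 := by
      intro x y hxy
      have ha := confDist_toReal_le hG ω o hxy
      have hb := confDist_toReal_le hG ω o hxy.symm
      have habs : |f x - f y| ≤ ((ω x : ℝ) + ω y) / 2 / R := by
        refine (abs_max_sub_max_le_max _ _ _ _).trans ?_
        rw [sub_self, abs_zero, max_eq_right (abs_nonneg _), sub_sub_sub_cancel_left, ← sub_div,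
          abs_div, abs_of_pos hR]
        gcongr
        rw [abs_le]
        constructor <;> simp only [hd] <;> linarith
      rw [← sq_abs]
      refine (pow_le_pow_left₀ (abs_nonneg _) habs 2).trans ?_
      rw [div_pow]
      gcongr
      nlinarith [sq_nonneg ((ω x : ℝ) - ω y)]
    have hcard : ∀ x, (((hfin x).toFinset.card : ℕ) : ℝ) ≤ D := by
      intro x
      have := hD x
      rw [(hfin x).encard_eq_coe_toFinset_card] at this
      exact_mod_cast this
    have hvert : ∀ x, ∑ y ∈ (hfin x).toFinset, (f x - f y) ^ 2 ≤
        (D + 1) / R ^ 2 * ∑ y ∈ I x, (ω y : ℝ) ^ 2 := by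
      intro x
      set σ := ∑ y ∈ (hfin x).toFinset, (ω y : ℝ) ^ 2 with hσ
      have hσ0 : 0 ≤ σ := Finset.sum_nonneg fun y _ => sq_nonneg _
      have hIx : ∑ y ∈ I x, (ω y : ℝ) ^ 2 = (ω x : ℝ) ^ 2 + σ :=
        Finset.sum_insert (by simp)
      calc ∑ y ∈ (hfin x).toFinset, (f x - f y) ^ 2
          ≤ ∑ y ∈ (hfin x).toFinset, ((ω x : ℝ) ^ 2 + (ω y) ^ 2) / 2 / R ^ 2 :=
            Finset.sum_le_sum fun y hy => hlip x y (by simpa using hy)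
        _ = ((hfin x).toFinset.card * (ω x : ℝ) ^ 2 + σ) / 2 / R ^ 2 := by
            rw [← Finset.sum_div, ← Finset.sum_div, Finset.sum_add_distrib, Finset.sum_const,
              nsmul_eq_mul]
        _ ≤ (D * (ω x : ℝ) ^ 2 + σ) / 2 / R ^ 2 := by
            gcongr
            exact_mod_cast hcard x
        _ ≤ ((D + 1) * ((ω x : ℝ) ^ 2 + σ)) / R ^ 2 := by
            gcongr
            nlinarith [mul_nonneg (Nat.cast_nonneg (α := ℝ) D) hσ0,
              mul_nonneg (Nat.cast_nonneg (α := ℝ) D) (sq_nonneg (ω x : ℝ)), sq_nonneg (ω x : ℝ)]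
        _ = _ := by rw [hIx]; ring
    have htot : ∑ x ∈ S, ∑ y ∈ I x, (ω y : ℝ) ^ 2 ≤ t * R ^ 2 := by
      have hE : ∑ x ∈ S, ∑ y ∈ I x, (ω y : ℝ≥0∞) ^ 2 ≤ ENNReal.ofReal (t * R ^ 2) := by
        refine le_trans ?_ ((ENNReal.sum_le_tsum S).trans h1)
        refine Finset.sum_le_sum fun x hx => ?_
        rw [confSquare, if_pos ((hlt x).2 ((hmem x).1 hx))]
        refine le_trans (Finset.sum_le_sum fun y hy => ?_) (ENNReal.sum_le_tsum (I x))
        rw [nearSquare, if_pos]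
        rcases Finset.mem_insert.1 hy with rfl | hy
        · simp
        · exact (SimpleGraph.dist_eq_one_iff_adj.2 (by simpa using hy)).le
      have hcast : ∑ x ∈ S, ∑ y ∈ I x, (ω y : ℝ≥0∞) ^ 2
          = ((∑ x ∈ S, ∑ y ∈ I x, (ω y) ^ 2 : ℝ≥0) : ℝ≥0∞) := by push_cast; rfl
      rw [hcast, ← ENNReal.ofReal_coe_nnreal, ENNReal.ofReal_le_ofReal_iff (by positivity)] at hE
      exact_mod_cast hE
    calc _ ≤ ∑ x ∈ S, (D + 1) / R ^ 2 * ∑ y ∈ I x, (ω y : ℝ) ^ 2 :=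
          Finset.sum_le_sum fun x _ => hvert x
      _ ≤ (D + 1) / R ^ 2 * (t * R ^ 2) := by
          rw [← Finset.mul_sum]
          gcongr
      _ = (D + 1) * t := by field_simp

/-! ## Recurrence -/

theorem measure_not_hasCutoff_le {μ : Measure RootedGraph} {ν : Measure RootedConformalGraph}
    (hν : IsNormalizedConformalMetric μ ν) [IsProbabilityMeasure μ] {D : ℕ}
    (hD : ∀ᵐ X ∂μ, (X.graph.neighborSet X.root).encard ≤ (D : ℕ∞)) {C R t : ℝ} (hR : 0 < R)
    (ht : 0 < t) (hC : 0 ≤ C) (hball : ballGrowth ν R ≤ ENNReal.ofReal (C * R ^ 2)) (k : ℕ) :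
    μ {X | ¬ HasCutoff X.graph X.locallyFinite X.root ((D + 1) * t) k} ≤
      ENNReal.ofReal (C * (D + 1) / t) +
        ENNReal.ofReal ((D + 1) ^ k * ((k : ℝ) + 1) ^ 4 / R ^ 2) := by
  have hmap : AEMeasurable RootedNetwork.forget ν := by
    -- A pushforward along a map that is not almost everywhere measurable is zero by convention;
    -- here it is a probability measure.
    refine AEMeasurable.of_map_ne_zero ?_
    rw [hν.map_forget]
    exact IsProbabilityMeasure.ne_zero μ
  have hdeg : ∀ᵐ X ∂ν, ∀ x, (X.graph.neighborSet x).encard ≤ (D : ℕ∞) := by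
    refine ae_degree_le hν.isUnimodular ?_
    have := hD
    rw [← hν.map_forget] at this
    exact ae_of_ae_map hmap this
  have hballae : ∀ᵐ X ∂ν, ((confBall X.graph X.mark X.root R).encard : ℝ≥0∞)
      ≤ ENNReal.ofReal (C * R ^ 2) := by
    filter_upwards [ae_le_essSup (μ := ν)
      (f := fun X => ((confBall X.graph X.mark X.root R).encard : ℝ≥0∞))] with X hX
    exact hX.trans hball
  have hI1 := lintegral_confSquare_le hν.isUnimodular hdeg hν.normalized ENNReal.ofReal_ne_top
    hballae
  have hI2 := lintegral_nearSquare_le hν.isUnimodular hdeg hν.normalized k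
  have hm1 := (locallyLowerSemicontinuous_confSquare (ENNReal.ofReal R)).measurable_tsum
  have hm2 := (locallyLowerSemicontinuous_nearSquare k).measurable_tsum
  have hs1 : 0 < t * R ^ 2 := by positivity
  have hs2 : 0 < (R / ((k : ℝ) + 1) ^ 2) ^ 2 := by positivity
  have hM1 := meas_ge_le_lintegral_div hm1.aemeasurable (μ := ν)
    (ENNReal.ofReal_pos.2 hs1).ne' ENNReal.ofReal_ne_top
  have hM2 := meas_ge_le_lintegral_div hm2.aemeasurable (μ := ν)
    (ENNReal.ofReal_pos.2 hs2).ne' ENNReal.ofReal_ne_top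
  have hopen := RootedNetwork.isOpen_setOf_hasCutoff (M := Unit) ((D + 1) * t) k
  have hmeas : MeasurableSet
      {X : RootedGraph | ¬ HasCutoff X.graph X.locallyFinite X.root ((D + 1) * t) k} :=
    hopen.measurableSet.compl
  rw [← hν.map_forget, Measure.map_apply_of_aemeasurable hmap hmeas]
  -- Without a cutoff one of the two sums exceeds its threshold; Markov's inequality bounds each of
  -- these events.
  refine le_trans (measure_mono_ae (t := _ ∪ _) ?_) ((measure_union_le _ _).trans
    (add_le_add (hM1.trans ?_) (hM2.trans ?_)))
  · filter_upwards [hdeg, hballae] with X hX1 hX2 hX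
    by_contra hcon
    obtain ⟨hc1, hc2⟩ := not_or.1 hcon
    refine hX (hasCutoff_of_confSquare_le X.connected X.locallyFinite hX1 X.mark X.root hR ht.le
      ?_ k (not_le.1 hc1).le (not_le.1 hc2).le)
    rw [← Set.encard_lt_top_iff, ← ENat.toENNReal_lt]
    exact hX2.trans_lt (by simp)
  · refine (ENNReal.div_le_div_right hI1 _).trans ?_
    rw [← ENNReal.ofReal_natCast, ← ENNReal.ofReal_mul (by positivity),
      ← ENNReal.ofReal_div_of_pos hs1]
    refine ENNReal.ofReal_le_ofReal (le_of_eq ?_)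
    push_cast
    field_simp
  · refine (ENNReal.div_le_div_right hI2 _).trans ?_
    rw [← ENNReal.ofReal_natCast, ← ENNReal.ofReal_div_of_pos hs2]
    refine ENNReal.ofReal_le_ofReal (le_of_eq ?_)
    push_cast
    field_simp

end

theorem mainTheorem2 (μ : Measure RootedGraph) (hμ : IsUnimodular μ)
    (hgrowth : HasAsymptoticGQCG μ)
    (hdeg : essSup (fun X : RootedGraph => X.rootDegree) μ < ⊤) :
    ∀ᵐ X ∂μ, IsRecurrent X.graph X.locallyFinite := by
  have := hμ.isProbabilityMeasure
  obtain ⟨C, hC, R, hR1, hR, hquad⟩ := hgrowth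
  obtain ⟨D, hD⟩ := ENNReal.exists_nat_gt hdeg.ne
  have hDae : ∀ᵐ X ∂μ, (X.graph.neighborSet X.root).encard ≤ (D : ℕ∞) := by
    filter_upwards [ae_le_essSup (μ := μ) (f := fun X : RootedGraph => X.rootDegree)] with X hX
    have h : ((X.graph.neighborSet X.root).encard : ℝ≥0∞) ≤ D := hX.trans hD.le
    exact_mod_cast ENat.toENNReal_le.1 (by simpa using h)
  set B : ℝ → ℕ → Set RootedGraph := fun t k =>
    {X | ¬ HasCutoff X.graph X.locallyFinite X.root ((D + 1) * t) k} with hB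
  have hbound : ∀ t : ℝ, 0 < t → ∀ k, μ (B t k) ≤ ENNReal.ofReal ((C + 1) * (D + 1) / t) := by
    intro t ht k
    have hn : ∀ n, μ (B t k) ≤ ENNReal.ofReal ((C + 1) * (D + 1) / t) +
        ENNReal.ofReal ((D + 1) ^ k * ((k : ℝ) + 1) ^ 4 / R n ^ 2) := by
      intro n
      have hRn : 0 < R n := zero_lt_one.trans_le (hR1 n)
      -- The infimum over metrics need not be attained, so `C` is relaxed to `C + 1`.
      have hlt : ENNReal.ofReal (C * R n ^ 2) < ENNReal.ofReal ((C + 1) * R n ^ 2) :=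
        (ENNReal.ofReal_lt_ofReal_iff (by positivity)).2 (by nlinarith [pow_pos hRn 2])
      obtain ⟨ν, hν⟩ := iInf_lt_iff.1 ((hquad n).trans_lt hlt)
      obtain ⟨hν, hball⟩ := iInf_lt_iff.1 hν
      exact measure_not_hasCutoff_le hν hDae hRn ht (by positivity) hball.le k
    -- The event `B t k` does not involve `n`, so the second term can be sent to zero with `t` and
    -- `k` fixed.
    have hlim : Tendsto (fun n => ENNReal.ofReal ((C + 1) * (D + 1) / t) +
        ENNReal.ofReal ((D + 1) ^ k * ((k : ℝ) + 1) ^ 4 / R n ^ 2)) atTop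
        (𝓝 (ENNReal.ofReal ((C + 1) * (D + 1) / t) + ENNReal.ofReal 0)) :=
      tendsto_const_nhds.add (ENNReal.tendsto_ofReal
        (((tendsto_pow_atTop two_ne_zero).comp hR).const_div_atTop _))
    simpa using ge_of_tendsto' hlim hn
  rw [ae_iff]
  have hle : ∀ t : ℝ, 0 < t → μ {X | ¬ IsRecurrent X.graph X.locallyFinite} ≤
      ENNReal.ofReal ((C + 1) * (D + 1) / t) := by
    intro t ht
    have hmono : Monotone (B t) := fun j k hjk X hX hcut => hX (hcut.mono hjk)
    -- Monotonicity of the outer measure suffices, so measurability of the recurrence event is never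
    -- required.
    calc μ {X | ¬ IsRecurrent X.graph X.locallyFinite} ≤ μ (⋃ k, B t k) := by
          refine measure_mono fun X hX => ?_
          by_contra hcon
          simp only [hB, Set.mem_iUnion, Set.mem_ofPred_eq, not_exists, not_not] at hcon
          exact hX (isRecurrent_of_cutoff X.locallyFinite hcon)
      _ = ⨆ k, μ (B t k) := hmono.measure_iUnion
      _ ≤ _ := iSup_le (hbound t ht)
  have hlim : Tendsto (fun t : ℝ => ENNReal.ofReal ((C + 1) * (D + 1) / t)) atTop
      (𝓝 (ENNReal.ofReal 0)) :=
    ENNReal.tendsto_ofReal (tendsto_id.const_div_atTop _)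
  rw [ENNReal.ofReal_zero] at hlim
  exact le_antisymm (ge_of_tendsto hlim ((eventually_gt_atTop 0).mono hle)) (zero_le)
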